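/- Let $U$ be a field containing $\mathbb{C}$, with a $\mathbb{C}$-linear derivation $'$, and let $t\in U$ satisfy $t'=1$ (for instance, a saturated differentially closed field with field of constants $\mathbb{C}$). Put $K=\mathbb{C}(t)\subseteq U$. For $v_1,v_2\in\mathbb{C}$ let $S_{III}(v_1,v_2)$ be the set of $(y,x)\in U^2$ with $$y'=\tfrac1t\left(2y^2x-y^2+v_1y+t\right),\qquad x'=\tfrac1t\left(-2yx^2+2yx-v_1x+\tfrac12(v_1+v_2)\right),$$ and for $v\in\mathbb{C}$ let $ric(v)\subseteq S_{III}(v,v)$ be the Riccati variety given by $y'=\frac1t(y^2+vy+t)$, $x=1$. The following Bäcklund transformations are bijections, definable over $K$, between the solution sets $S_{III}$ for the indicated parameters: - $(v_1,v_2)\mapsto(v_2,v_1)$, $\ (y,x)\mapsto\left(y+\frac{v_1-v_2}{2(x-1)},\,x\right)$ (the identity if $v_1=v_2$); - $(v_1,v_2)\mapsto(-v_2,-v_1)$, $\ (y,x)\mapsto\left(y+\frac{v_1+v_2}{2x},\,x\right)$ (the identity if $v_1+v_2=0$); - $(v_1,v_2)\mapsto(v_2+1,v_1-1)$, $\ (y,x)\mapsto\left(\frac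 ty,\,-\frac yt\left(yx+\frac{v_1+v_2}{2}\right)\right)$; - $(v_1,v_2)\mapsto(2-v_1,-v_2)$, $\ (y,x)\mapsto\left(-y,\,1-x+\frac{1-v_1}{y}-\frac{t}{y^2}\right)$. Let $\mathcal{R}(v_1,v_2)\subseteq S_{III}(v_1,v_2)$ be the set of all solutions that are obtained, by a finite composition of these transformations with parameters leading from some $(v,v)$ to $(v_1,v_2)$, from a point of $ric(v)$. **Proposition.** Suppose that $v_1-v_2\in2\mathbb{Z}$ and $v_1\notin\frac12+\mathbb{Z}$. If $(y_1,x_1)$ and $(y_2,x_2)$ are distinct points of $\mathcal{R}(v_1,v_2)$, then they are algebraically independent over $K$: $\operatorname{tr.deg}_K K(y_1,x_1,y_2,x_2)=2$, and $y_1,y_2$ are algebraically independent over $K$. -/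

import Mathlib

open scoped IntermediateField

namespace PainleveThree

/-!
Throughout, `U` is a field extension of `ℂ` with a `ℂ`-linear derivation `D`, and `t : U` is an
element with `D t = 1`. A point of `U × U` is written `(y, x)`, as in the Hamiltonian system.
-/

/-- The solution set in `U × U` of the Hamiltonian form `S_III(v₁, v₂)` of the third Painlevé
equation, `y' = (2y²x - y² + v₁y + t)/t`, `x' = (-2yx² + 2yx - v₁x + (v₁ + v₂)/2)/t`. -/
def systemIII {U : Type*} [Field U] [Algebra ℂ U] (D : Derivation ℂ U U) (t : U) (v₁ v₂ : ℂ) :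
    Set (U × U) :=
  {P | D P.1 = (1 / t) * (2 * P.1 ^ 2 * P.2 - P.1 ^ 2 + algebraMap ℂ U v₁ * P.1 + t) ∧
       D P.2 = (1 / t) * (-2 * P.1 * P.2 ^ 2 + 2 * P.1 * P.2 - algebraMap ℂ U v₁ * P.2
          + algebraMap ℂ U ((v₁ + v₂) / 2))}

/-- The Riccati variety `ric(v)`: `y' = (y² + vy + t)/t` and `x = 1`. -/
def ric {U : Type*} [Field U] [Algebra ℂ U] (D : Derivation ℂ U U) (t : U) (v : ℂ) :
    Set (U × U) :=
  {P | D P.1 = (1 / t) * (P.1 ^ 2 + algebraMap ℂ U v * P.1 + t) ∧ P.2 = 1}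

/-- Bäcklund transformation `S_III(v₁, v₂) → S_III(v₂, v₁)`. On a solution, `x = 1` forces
`v₁ = v₂`, and for `v₁ = v₂` the map is the identity (also with the convention `0 / 0 = 0`). -/
noncomputable def backlundS {U : Type*} [Field U] [Algebra ℂ U] (v₁ v₂ : ℂ) (P : U × U) : U × U :=
  (P.1 + algebraMap ℂ U (v₁ - v₂) / (2 * (P.2 - 1)), P.2)

/-- Bäcklund transformation `S_III(v₁, v₂) → S_III(-v₂, -v₁)`. On a solution, `x = 0` forces
`v₁ + v₂ = 0`, and for `v₁ + v₂ = 0` the map is the identity (also with the convention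
`0 / 0 = 0`). -/
noncomputable def backlundR {U : Type*} [Field U] [Algebra ℂ U] (v₁ v₂ : ℂ) (P : U × U) : U × U :=
  (P.1 + algebraMap ℂ U (v₁ + v₂) / (2 * P.2), P.2)

/-- Bäcklund transformation `S_III(v₁, v₂) → S_III(v₂ + 1, v₁ - 1)`, with `y ↦ t / y`. A solution
has `y ≠ 0`, because `y = 0` would give `y' = 1`. -/
noncomputable def backlundInv {U : Type*} [Field U] [Algebra ℂ U] (t : U) (v₁ v₂ : ℂ) (P : U × U) : U × U :=
  (t / P.1, -(P.1 / t) * (P.1 * P.2 + algebraMap ℂ U ((v₁ + v₂) / 2)))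

/-- Bäcklund transformation `S_III(v₁, v₂) → S_III(2 - v₁, -v₂)`, with `y ↦ -y`. -/
noncomputable def backlundNeg {U : Type*} [Field U] [Algebra ℂ U] (t : U) (v₁ : ℂ) (P : U × U) : U × U :=
  (-P.1, 1 - P.2 + algebraMap ℂ U (1 - v₁) / P.1 - t / P.1 ^ 2)

/-- `RiccatiOrbit D t v₁ v₂ P`: the point `P`, at the parameters `(v₁, v₂)`, is obtained from a
point of some `ric(v)`, at the parameters `(v, v)`, by a finite composition of Bäcklund
transformations. (The four maps are involutions, so inverses need not be added.) -/
inductive RiccatiOrbit {U : Type*} [Field U] [Algebra ℂ U] (D : Derivation ℂ U U) (t : U) :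
    ℂ → ℂ → U × U → Prop
  | base (v : ℂ) (P : U × U) (hP : P ∈ ric D t v) : RiccatiOrbit D t v v P
  | stepS (v₁ v₂ : ℂ) (P : U × U) (h : RiccatiOrbit D t v₁ v₂ P) :
      RiccatiOrbit D t v₂ v₁ (backlundS v₁ v₂ P)
  | stepR (v₁ v₂ : ℂ) (P : U × U) (h : RiccatiOrbit D t v₁ v₂ P) :
      RiccatiOrbit D t (-v₂) (-v₁) (backlundR v₁ v₂ P)
  | stepInv (v₁ v₂ : ℂ) (P : U × U) (h : RiccatiOrbit D t v₁ v₂ P) :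
      RiccatiOrbit D t (v₂ + 1) (v₁ - 1) (backlundInv t v₁ v₂ P)
  | stepNeg (v₁ v₂ : ℂ) (P : U × U) (h : RiccatiOrbit D t v₁ v₂ P) :
      RiccatiOrbit D t (2 - v₁) (-v₂) (backlundNeg t v₁ P)

/-- The Riccati subvariety `R(v₁, v₂)` of `S_III(v₁, v₂)`: the solutions obtained from the Riccati
varieties `ric(v)` by Bäcklund transformations. -/
def riccatiSubvariety {U : Type*} [Field U] [Algebra ℂ U] (D : Derivation ℂ U U) (t : U)
    (v₁ v₂ : ℂ) : Set (U × U) :=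
  {P | P ∈ systemIII D t v₁ v₂ ∧ RiccatiOrbit D t v₁ v₂ P}

end PainleveThree

/-! The first half is a normal form for orbits. On solutions, `backlundNeg` is `backlundMu` followed
by `backlundInv`, while `backlundMu` and `backlundR` commute with `backlundS` and `backlundInv` and
send Riccati varieties to Riccati varieties. Hence every orbit point is an alternating word in the
two involutions `backlundInv`, `backlundS` applied to a point of some ric(w)
(`RiccatiOrbit.isChainPoint`). Since w = (v₁ + v₂)/2 and v₁ - v₂ determines the word, two points
with the same parameters come from one ric(w) by one map, birational over K = ℂ(t)
(`IsChainPoint.exists_common_chain`); w stays outside 1/2 + ℤ.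

The second half treats θy = y² + wy + t with θ = t d/dt. If y is algebraic over K, its minimal
polynomial divides its own derivative along the Riccati vector field.
`not_dvd_riccatiDeriv_of_irreducible` excludes this: expansions at t = ∞ bound the degree by 2,
degree 1 would give a rational solution, and in degree 2 the zeros and poles of the discriminant
force w ∈ 1/2 + ℤ. If a second solution z is algebraic over K(y), then (y - z)⁻¹ solves a linear
equation over K(y). Averaging conjugates yields a solution in K(y); its denominator is invariant,
hence constant, and a polynomial solution fails at its leading coefficient
(`transcendental_over_adjoin`).

The transcendence degree then transfers because the word is birational. For the first coordinates
alone, x is recovered from y and y′, and the exchange property of algebraic closure finishes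
(`transcendental_chain`, `transcendental_adjoin_of_interalgebraic`). -/

/-! ### Formal solutions of the Riccati equation at t = ∞. -/

namespace PainleveThree

open Polynomial
open scoped Differential LaurentSeries

/-- The operator `t d/dt` on Laurent series in `s = t^{-1/2}`, so `s ^ n ↦ -(n / 2) s ^ n`. -/
noncomputable def eulerLaurent (f : LaurentSeries ℂ) : LaurentSeries ℂ where
  coeff n := (-(n : ℂ) / 2) * f.coeff n
  isPWO_support' := f.isPWO_support.mono (fun n hn => by
    simp only [Function.mem_support] at hn
    exact fun h => hn (by rw [h, mul_zero]))

theorem support_eulerLaurent (f : LaurentSeries ℂ) : (eulerLaurent f).support ⊆ f.support :=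
  fun n hn h => hn (by
    change (-(n : ℂ) / 2) * f.coeff n = 0
    rw [h, mul_zero])

theorem eulerLaurent_mul (f g : LaurentSeries ℂ) :
    eulerLaurent (f * g) = f * eulerLaurent g + g * eulerLaurent f := by
  ext n
  rw [HahnSeries.coeff_add, mul_comm g,
    HahnSeries.coeff_mul_left' f.isPWO_support (support_eulerLaurent f),
    HahnSeries.coeff_mul_right' g.isPWO_support (support_eulerLaurent g)]
  change (-(n : ℂ) / 2) * (f * g).coeff n = _
  rw [HahnSeries.coeff_mul, Finset.mul_sum, ← Finset.sum_add_distrib]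
  refine Finset.sum_congr rfl fun ij hij => ?_
  have : ij.1 + ij.2 = n := (Finset.mem_antidiagonal.mp hij).2.2
  change _ = f.coeff ij.1 * ((-(ij.2 : ℂ) / 2) * g.coeff ij.2) +
    ((-(ij.1 : ℂ) / 2) * f.coeff ij.1) * g.coeff ij.2
  rw [← this]
  push_cast
  ring

/-- The differential ring given by an additive map that satisfies the Leibniz rule. -/
@[reducible]
def differentialOfLeibniz {R : Type*} [CommRing R] (f : R →+ R)
    (h : ∀ a b, f (a * b) = a * f b + b * f a) : Differential R :=
  ⟨Derivation.mk' f.toIntLinearMap h⟩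

noncomputable instance : Differential (LaurentSeries ℂ) :=
  differentialOfLeibniz
    { toFun := eulerLaurent
      map_zero' := by ext n; exact mul_zero _
      map_add' := fun f g => by ext n; exact mul_add _ _ _ } eulerLaurent_mul

theorem coeff_eulerLaurent (f : LaurentSeries ℂ) (n : ℤ) :
    (f′).coeff n = (-(n : ℂ) / 2) * f.coeff n := rfl

/-- A logarithmic derivative of a Laurent series has no pole. -/
theorem coeff_eq_zero_of_logDeriv {f g : LaurentSeries ℂ} (hf : f ≠ 0) (h : f′ = g * f) {n : ℤ}
    (hn : n < 0) : g.coeff n = 0 := by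
  by_contra hg
  have hg0 : g ≠ 0 := fun h0 => hg (by simp [h0])
  have h1 : (f′).coeff (g.order + f.order) = 0 := by
    rw [coeff_eulerLaurent, HahnSeries.coeff_eq_zero_of_lt_order, mul_zero]
    have := HahnSeries.order_le_of_coeff_ne_zero hg
    omega
  rw [h, HahnSeries.coeff_mul_order_add_order] at h1
  simp [hg0, hf] at h1

/-- Coefficients of the formal solution `y = ∑ aₙ s ^ (n - 1)` of the Riccati equation at `t = ∞`. -/
noncomputable def formalCoeff (ε v : ℂ) : ℕ → ℂ
  | 0 => ε
  | n + 1 => ((1 / 2 - v - n / 2) * formalCoeff ε v n -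
      ∑ i : Fin n, formalCoeff ε v (i + 1) * formalCoeff ε v (n - i)) / (2 * ε)

theorem formalCoeff_zero (ε v : ℂ) : formalCoeff ε v 0 = ε := by rw [formalCoeff]

theorem formalCoeff_succ (ε v : ℂ) (n : ℕ) : formalCoeff ε v (n + 1) =
    ((1 / 2 - v - n / 2) * formalCoeff ε v n -
      ∑ i ∈ Finset.range n, formalCoeff ε v (i + 1) * formalCoeff ε v (n - i)) / (2 * ε) := by
  rw [formalCoeff, Finset.sum_range]

/-- The two end terms of the convolution add up to 2ε times the newest coefficient, which is what
the recursion solves for. -/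
theorem sum_antidiagonal_formalCoeff {ε : ℂ} (hε : ε ≠ 0) (v : ℂ) (n : ℕ) :
    ∑ ij ∈ Finset.HasAntidiagonal.antidiagonal (n + 1), formalCoeff ε v ij.1 * formalCoeff ε v ij.2 =
      (1 / 2 - v - n / 2) * formalCoeff ε v n := by
  rw [Finset.Nat.sum_antidiagonal_eq_sum_range_succ_mk, Finset.sum_range_succ,
    Finset.sum_range_succ']
  have h := formalCoeff_succ ε v n
  rw [eq_div_iff (by simpa using hε)] at h
  simp only [Nat.sub_self, Nat.sub_zero, formalCoeff_zero, Nat.add_sub_add_right]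
  linear_combination h

/-- At infinity y² must cancel t, so y starts with ε s⁻¹ where ε² = -1. Each later coefficient
enters linearly with factor 2ε and is therefore determined. -/
theorem exists_formal_solution {ε : ℂ} (hε : ε ^ 2 = -1) (v : ℂ) :
    ∃ y : LaurentSeries ℂ, y′ = y ^ 2 + HahnSeries.C v * y + HahnSeries.single (-2) 1 ∧
      y.coeff (-1) = ε := by
  have hε0 : ε ≠ 0 := by rintro rfl; norm_num at hε
  set Y : PowerSeries ℂ := PowerSeries.mk (formalCoeff ε v) with hY
  have hmulcoeff : ∀ (g : LaurentSeries ℂ) (k n : ℤ),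
      (g * HahnSeries.single k (1 : ℂ)).coeff n = g.coeff (n - k) := by
    intro g k n
    have := HahnSeries.coeff_mul_single_add (x := g) (r := (1 : ℂ)) (a := n - k) (b := k)
    simpa using this
  refine ⟨(Y : LaurentSeries ℂ) * HahnSeries.single (-1) 1, ?_, ?_⟩
  · have hsq : ((Y : LaurentSeries ℂ) * HahnSeries.single (-1) (1 : ℂ)) ^ 2 =
        ((Y * Y : PowerSeries ℂ) : LaurentSeries ℂ) * HahnSeries.single (-2) (1 : ℂ) := by
      rw [PowerSeries.coe_mul, pow_two, mul_mul_mul_comm, HahnSeries.single_mul_single]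
      norm_num
    ext n
    rw [coeff_eulerLaurent, HahnSeries.coeff_add, HahnSeries.coeff_add, hsq,
      HahnSeries.C_mul_eq_smul, HahnSeries.coeff_smul, hmulcoeff, hmulcoeff,
      PowerSeries.coeff_coe, PowerSeries.coeff_coe, HahnSeries.coeff_single]
    rcases lt_trichotomy n (-2) with h | rfl | h
    · rw [if_pos (by omega), if_pos (by omega), if_neg (by omega)]; simp
    · simp only [PowerSeries.coeff_mul, hY, PowerSeries.coeff_mk]
      simp [formalCoeff_zero, ← pow_two, hε]
    · obtain ⟨m, rfl⟩ : ∃ m : ℕ, n = (m : ℤ) - 1 := ⟨(n + 1).toNat, by omega⟩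
      rw [if_neg (by omega), if_neg (by omega), if_neg (by omega)]
      have e1 : ((m : ℤ) - 1 - -1).natAbs = m := by omega
      have e2 : ((m : ℤ) - 1 - -2).natAbs = m + 1 := by omega
      rw [e1, e2, PowerSeries.coeff_mul]
      simp only [hY, PowerSeries.coeff_mk]
      rw [sum_antidiagonal_formalCoeff hε0]
      simp only [smul_eq_mul]
      push_cast; ring
  · rw [hmulcoeff, PowerSeries.coeff_coe]
    simp [hY, formalCoeff_zero]

end PainleveThree

/-! ### Polynomials invariant under the Riccati vector field. -/

namespace PainleveThree

open Polynomial
open scoped Differential LaurentSeries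

/-- If B = P^(k+1) R with P ∤ R, Leibniz leaves P ∣ (k + 1) R dP, and k + 1 is a unit in
characteristic zero. -/
theorem exists_irreducible_dvd_derivation {F : Type*} [Field F] [CharZero F] (d : Derivation ℤ F[X] F[X]) {B : F[X]}
    (hB : B ≠ 0) (hB' : ¬ IsUnit B) (h : B ∣ d B) :
    ∃ P : F[X], P.Monic ∧ Irreducible P ∧ P ∣ d P := by
  obtain ⟨P, hPm, hPi, hPB⟩ := exists_monic_irreducible_factor B hB'
  refine ⟨P, hPm, hPi, ?_⟩
  obtain ⟨R, hR, hPR⟩ := (FiniteMultiplicity.of_prime_left hPi.prime hB).exists_eq_pow_mul_and_not_dvd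
  obtain ⟨k, hk⟩ : ∃ k, multiplicity P B = k + 1 := by
    refine Nat.exists_eq_add_one.mpr (Nat.pos_of_ne_zero fun h0 => ?_)
    rw [h0, pow_zero, one_mul] at hR
    exact hPR (hR ▸ hPB)
  rw [hk] at hR
  rw [hR, Derivation.leibniz, Derivation.leibniz_pow] at h
  simp only [smul_eq_mul, nsmul_eq_mul, Nat.add_sub_cancel] at h
  have h1 : P ^ (k + 1) ∣ R * (((k + 1 : ℕ) : F[X]) * (P ^ k * d P)) :=
    (dvd_add_right (dvd_mul_right _ _)).mp ((dvd_mul_right _ _).trans h)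
  have h2 : P ∣ R * (((k + 1 : ℕ) : F[X]) * d P) := by
    apply (mul_dvd_mul_iff_left (pow_ne_zero k hPi.ne_zero)).mp
    rw [← pow_succ]
    convert h1 using 1
    ring
  refine ((hPi.prime.dvd_mul.mp h2).resolve_left hPR |> hPi.prime.dvd_mul.mp).resolve_left ?_
  intro h3
  have : IsUnit (((k + 1 : ℕ) : F[X])) := by
    rw [← C_eq_natCast]
    exact isUnit_C.mpr (IsUnit.mk0 _ (by exact_mod_cast k.succ_ne_zero))
  exact hPi.not_isUnit (isUnit_of_dvd_unit h3 this)

section Invariant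

variable {F : Type*} [Field F] [Differential F]

/-- The derivation of `F[Y]` extending the one of `F` with `Y′ = Y² + v Y + τ`. -/
noncomputable def riccatiDeriv (v τ : F) : Derivation ℤ F[X] F[X] :=
  Differential.implicitDeriv (X ^ 2 + C v * X + C τ)

theorem riccatiDeriv_apply (v τ : F) (P : F[X]) : riccatiDeriv v τ P =
    Differential.mapCoeffs P + (X ^ 2 + C v * X + C τ) * derivative P := by
  simp [riccatiDeriv, Differential.implicitDeriv]

theorem coeff_riccatiDeriv_zero (v τ : F) (P : F[X]) :
    (riccatiDeriv v τ P).coeff 0 = (P.coeff 0)′ + τ * P.coeff 1 := by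
  simp [riccatiDeriv_apply, mul_coeff_zero, coeff_derivative]

theorem coeff_riccatiDeriv_succ (v τ : F) (P : F[X]) (k : ℕ) :
    (riccatiDeriv v τ P).coeff (k + 1) = (P.coeff (k + 1))′ + k * P.coeff k +
      v * (k + 1) * P.coeff (k + 1) + τ * (k + 2) * P.coeff (k + 2) := by
  have h2 : (X ^ 2 * derivative P).coeff (k + 1) = k * P.coeff k := by
    rcases k with _ | k
    · simp [coeff_X_pow_mul']
    · rw [coeff_X_pow_mul, coeff_derivative]; push_cast; ring
  rw [riccatiDeriv_apply, coeff_add, Differential.coeff_mapCoeffs, add_mul, add_mul, coeff_add,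
    coeff_add, h2, mul_assoc (C v), coeff_C_mul, coeff_C_mul, coeff_X_mul, coeff_derivative,
    coeff_derivative]
  push_cast
  ring

theorem natDegree_riccatiDeriv_le (v τ : F) (P : F[X]) :
    (riccatiDeriv v τ P).natDegree ≤ P.natDegree + 1 := by
  rw [natDegree_le_iff_coeff_eq_zero]
  intro N hN
  obtain ⟨k, rfl⟩ : ∃ k, N = k + 1 := ⟨N - 1, by omega⟩
  rw [coeff_riccatiDeriv_succ, coeff_eq_zero_of_natDegree_lt (n := k) (by omega),
    coeff_eq_zero_of_natDegree_lt (n := k + 1) (by omega),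
    coeff_eq_zero_of_natDegree_lt (n := k + 2) (by omega)]
  simp

/-- The vector field raises degree by at most one, so the cofactor is linear; its slope is the
degree of P because Y² d/dY sends Yⁿ to n Yⁿ⁺¹. -/
theorem riccatiDeriv_eq_of_dvd {v τ : F} {P : F[X]} (hP : P.Monic) (h : P ∣ riccatiDeriv v τ P) :
    ∃ c : F, riccatiDeriv v τ P = (C (P.natDegree : F) * X + C c) * P := by
  obtain ⟨Q, hQ⟩ := h
  have hdeg : Q.natDegree ≤ 1 := by
    by_cases hQ0 : Q = 0
    · simp [hQ0]
    have h1 := natDegree_riccatiDeriv_le v τ P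
    rw [hQ, natDegree_mul hP.ne_zero hQ0] at h1
    omega
  have hlead : Q.coeff 1 = P.natDegree := by
    have h1 := coeff_riccatiDeriv_succ v τ P P.natDegree
    rw [hQ, coeff_mul_add_eq_of_natDegree_le le_rfl hdeg, hP.coeff_natDegree,
      coeff_eq_zero_of_natDegree_lt (n := P.natDegree + 1) (by omega),
      coeff_eq_zero_of_natDegree_lt (n := P.natDegree + 2) (by omega)] at h1
    simpa using h1
  refine ⟨Q.coeff 0, ?_⟩
  rw [hQ, mul_comm, ← hlead]
  congr 1
  exact eq_X_add_C_of_natDegree_le_one hdeg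

theorem deriv_aeval_eq_aeval_riccatiDeriv {A : Type*} [Field A] [Differential A] [Algebra F A]
    [DifferentialAlgebra F A] {v τ : F} {y : A}
    (hy : y′ = y ^ 2 + algebraMap F A v * y + algebraMap F A τ) (P : F[X]) :
    (aeval y P)′ = aeval y (riccatiDeriv v τ P) :=
  Differential.deriv_aeval_eq_implicitDeriv y _ (by simpa using hy) P

theorem deriv_eval_eq_eval_riccatiDeriv {v τ y : F} (hy : y′ = y ^ 2 + v * y + τ) (P : F[X]) :
    (P.eval y)′ = (riccatiDeriv v τ P).eval y := by
  simpa [coe_aeval_eq_eval] using deriv_aeval_eq_aeval_riccatiDeriv (A := F) (v := v) (τ := τ) hy P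

/-- The factor X - y is itself invariant with cofactor X + y + v, and cofactors add over products.
Removing a root thus lowers the slope by one. -/
theorem riccatiDeriv_of_X_sub_C_mul {v τ y a c : F} (hy : y′ = y ^ 2 + v * y + τ) {Q : F[X]}
    (h : riccatiDeriv v τ ((X - C y) * Q) = (C a * X + C c) * ((X - C y) * Q)) :
    riccatiDeriv v τ Q = (C (a - 1) * X + C (c - y - v)) * Q := by
  have h1 : riccatiDeriv v τ (X - C y) = (X - C y) * (X + C (y + v)) := by
    rw [map_sub]
    simp only [riccatiDeriv, Differential.implicitDeriv_X, Differential.implicitDeriv_C, hy]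
    simp only [C_add, C_mul, C_pow]
    ring
  rw [Derivation.leibniz, h1, smul_eq_mul, smul_eq_mul] at h
  apply mul_left_cancel₀ (X_sub_C_ne_zero y)
  simp only [C_sub, C_add, C_1] at h ⊢
  linear_combination h

theorem deriv_div_of_logDeriv {a b p q : F} (ha : a′ = p * a) (hb : b′ = q * b) (hb0 : b ≠ 0) :
    (a / b)′ = (p - q) * (a / b) := by
  rw [Derivation.leibniz_div, ha, hb]
  simp only [smul_eq_mul]
  field_simp

end Invariant

/-- A nonvanishing pair of formal solutions with opposite leading terms forces degree zero. -/
theorem eq_zero_of_eval_formal_ne_zero {v τ c y z : LaurentSeries ℂ} {m : ℤ}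
    (hy : y′ = y ^ 2 + v * y + τ) (hz : z′ = z ^ 2 + v * z + τ)
    (hyz : y.coeff (-1) ≠ z.coeff (-1)) {P : (LaurentSeries ℂ)[X]}
    (h : riccatiDeriv v τ P = (C (m : LaurentSeries ℂ) * X + C c) * P)
    (hPy : P.eval y ≠ 0) (hPz : P.eval z ≠ 0) : m = 0 := by
  have h1 := deriv_eval_eq_eval_riccatiDeriv hy P
  have h2 := deriv_eval_eq_eval_riccatiDeriv hz P
  rw [h] at h1 h2
  simp only [eval_mul, eval_add, eval_C, eval_X] at h1 h2
  -- The part of the cofactor independent of Y cancels in the quotient. What remains, m(y - z), has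
  -- a pole in s unless m = 0.
  have h3 : (P.eval y / P.eval z)′ = HahnSeries.C (m : ℂ) * (y - z) * (P.eval y / P.eval z) := by
    rw [deriv_div_of_logDeriv h1 h2 hPz, map_intCast]
    ring
  have h4 := coeff_eq_zero_of_logDeriv (div_ne_zero hPy hPz) h3 (n := -1) (by norm_num)
  rw [HahnSeries.C_mul_eq_smul, HahnSeries.coeff_smul, HahnSeries.coeff_sub, smul_eq_mul, mul_eq_zero, sub_eq_zero] at h4
  exact_mod_cast h4.resolve_right hyz

/-- A squarefree invariant polynomial has only the two formal solutions at infinity as roots. -/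
theorem le_two_of_squarefree_invariant (v : ℂ) {c : LaurentSeries ℂ} {n : ℕ}
    {P : (LaurentSeries ℂ)[X]} (hP : Squarefree P)
    (h : riccatiDeriv (HahnSeries.C v) (HahnSeries.single (-2) 1) P =
      (C (n : LaurentSeries ℂ) * X + C c) * P) : n ≤ 2 := by
  obtain ⟨y, hy, hyc⟩ := exists_formal_solution (ε := Complex.I) Complex.I_sq v
  obtain ⟨z, hz, hzc⟩ := exists_formal_solution (ε := -Complex.I) (by simp) v
  have hne : y.coeff (-1) ≠ z.coeff (-1) := by
    rw [hyc, hzc]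
    exact fun h0 => Complex.I_ne_zero (CharZero.eq_neg_self_iff.mp h0)
  -- Squarefreeness lets each formal solution be divided out only once. After that the slope must be
  -- zero, so n counts the formal solutions among the roots.
  have key : ∀ {y z : LaurentSeries ℂ}, y′ = y ^ 2 + HahnSeries.C v * y + HahnSeries.single (-2) 1 →
      z′ = z ^ 2 + HahnSeries.C v * z + HahnSeries.single (-2) 1 → y.coeff (-1) ≠ z.coeff (-1) →
      P.eval y = 0 → n ≤ 2 := by
    intro y z hy hz hne hPy
    obtain ⟨Q, rfl⟩ := dvd_iff_isRoot.mpr hPy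
    have hQ := riccatiDeriv_of_X_sub_C_mul hy h
    have hQy : Q.eval y ≠ 0 := by
      intro h0
      obtain ⟨R, rfl⟩ := dvd_iff_isRoot.mpr h0
      exact not_isUnit_X_sub_C y (hP _ ⟨R, by ring⟩)
    by_cases hQz : Q.eval z = 0
    · obtain ⟨R, rfl⟩ := dvd_iff_isRoot.mpr hQz
      have hR := riccatiDeriv_of_X_sub_C_mul hz hQ
      have hRy : R.eval y ≠ 0 := fun h0 => hQy (by simp [h0])
      have hRz : R.eval z ≠ 0 := by
        intro h0
        obtain ⟨S, rfl⟩ := dvd_iff_isRoot.mpr h0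
        exact not_isUnit_X_sub_C z (hP _ ⟨(X - C y) * S, by ring⟩)
      have := eq_zero_of_eval_formal_ne_zero (m := (n : ℤ) - 1 - 1) hy hz hne
        (by push_cast; exact hR) hRy hRz
      omega
    · have := eq_zero_of_eval_formal_ne_zero (m := (n : ℤ) - 1) hy hz hne
        (by push_cast; exact hQ) hQy hQz
      omega
  by_cases hPy : P.eval y = 0
  · exact key hy hz hne hPy
  by_cases hPz : P.eval z = 0
  · exact key hz hy hne.symm hPz
  have := eq_zero_of_eval_formal_ne_zero (m := (n : ℤ)) hy hz hne (by push_cast; exact h) hPy hPz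
  omega

end PainleveThree

/-! ### Rational solutions, and the zeros and poles of an inverse discriminant. -/

namespace PainleveThree

open Polynomial

section EulerPolynomial

variable {k : Type*} [Field k]

theorem coeff_X_mul_derivative (A : k[X]) (n : ℕ) :
    (X * derivative A).coeff n = n * A.coeff n := by
  rcases n with _ | n
  · simp
  · rw [coeff_X_mul, coeff_derivative]; push_cast; ring

theorem natDegree_X_mul_derivative_le (A : k[X]) :
    (X * derivative A).natDegree ≤ A.natDegree := by
  rw [natDegree_le_iff_coeff_eq_zero]
  intro N hN
  rw [coeff_X_mul_derivative, coeff_eq_zero_of_natDegree_lt hN, mul_zero]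

theorem mul_X_mul_derivative_pow_mul (t₀ : k) (n : ℕ) (f : k[X]) :
    (X - C t₀) * (X * derivative ((X - C t₀) ^ n * f)) =
      (X - C t₀) ^ n * ((n : k[X]) * X * f + (X - C t₀) * (X * derivative f)) := by
  rcases n with _ | n
  · simp
  · rw [derivative_mul, derivative_X_sub_C_pow, Nat.add_sub_cancel]
    simp only [map_natCast]
    ring

theorem X_mul_derivative_X_pow_mul (n : ℕ) (f : k[X]) :
    X * derivative (X ^ n * f) = X ^ n * ((n : k[X]) * f + X * derivative f) := by
  rcases n with _ | n
  · simp
  · rw [derivative_mul, derivative_X_pow, Nat.add_sub_cancel]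
    simp only [map_natCast]
    ring

end EulerPolynomial

/-- The Riccati equation has no rational solution `A / B`. -/
theorem not_rational_riccati {A B : ℂ[X]} (hB : B ≠ 0) (v : ℂ)
    (h : X * derivative A * B - A * (X * derivative B) = A ^ 2 + C v * (A * B) + X * B ^ 2) :
    False := by
  have hl : (X * derivative A * B - A * (X * derivative B)).natDegree ≤
      A.natDegree + B.natDegree := by
    refine (natDegree_sub_le_of_le (natDegree_mul_le_of_le (natDegree_X_mul_derivative_le A) le_rfl)
      (natDegree_mul_le_of_le le_rfl (natDegree_X_mul_derivative_le B))).trans ?_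
    simp
  have hm : (C v * (A * B)).natDegree ≤ A.natDegree + B.natDegree :=
    (natDegree_C_mul_le _ _).trans natDegree_mul_le
  have hA2 : (A ^ 2).natDegree = 2 * A.natDegree := natDegree_pow A 2
  have hXB : (X * B ^ 2).natDegree = 2 * B.natDegree + 1 := by
    rw [natDegree_X_mul (pow_ne_zero 2 hB), natDegree_pow]
  -- The degrees of A² and tB² have opposite parity, so the larger of the two strictly dominates
  -- every other term.
  rcases le_or_gt A.natDegree B.natDegree with hab | hab
  · have h1 := congrArg (fun p => p.coeff (2 * B.natDegree + 1)) h
    simp only [coeff_add] at h1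
    rw [coeff_eq_zero_of_natDegree_lt (by omega), coeff_eq_zero_of_natDegree_lt (p := A ^ 2)
      (by omega), coeff_eq_zero_of_natDegree_lt (p := C v * (A * B)) (by omega), ← hXB,
      coeff_natDegree] at h1
    simp only [zero_add, add_zero, leadingCoeff_mul, leadingCoeff_X, one_mul, leadingCoeff_pow] at h1
    exact pow_ne_zero 2 (leadingCoeff_ne_zero.mpr hB) h1.symm
  · have hA : A ≠ 0 := by rintro rfl; simp at hab
    have h1 := congrArg (fun p => p.coeff (2 * A.natDegree)) h
    simp only [coeff_add] at h1
    rw [coeff_eq_zero_of_natDegree_lt (by omega), coeff_eq_zero_of_natDegree_lt (p := X * B ^ 2)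
      (by omega), coeff_eq_zero_of_natDegree_lt (p := C v * (A * B)) (by omega), ← hA2,
      coeff_natDegree] at h1
    simp only [add_zero, leadingCoeff_pow] at h1
    exact pow_ne_zero 2 (leadingCoeff_ne_zero.mpr hA) h1.symm

/-- `g = B / A` satisfies `-4 g θ²g + 3 (θg)² = -4 v² g² + 4 g + 16 t g²`, where `θ = t d/dt`. -/
def ProductEquation (v : ℂ) (A B : ℂ[X]) : Prop :=
  ∀ W : ℂ[X], W = X * derivative B * A - B * (X * derivative A) →
    -4 * B * (X * derivative W * A - 2 * W * (X * derivative A)) + 3 * W ^ 2 =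
      A ^ 2 * (-4 * C (v ^ 2) * B ^ 2 + 4 * B * A + 16 * X * B ^ 2)

/-- With n = b - a the order of g at t₀, the bracket in the value of S is n(4 - n). It is the
coefficient of the order 2n - 2 part of the differential side, against order n for 4g and at least
2n for the other terms. -/
theorem ProductEquation.local_expansion {v : ℂ} {t₀ : ℂ} {a b : ℕ} {A B : ℂ[X]}
    (h : ProductEquation v ((X - C t₀) ^ a * A) ((X - C t₀) ^ b * B)) :
    ∃ S R : ℂ[X], (X - C t₀) ^ (2 * a + 2 * b) * S = (X - C t₀) ^ (2 + 2 * a + 2 * b) * R +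
        4 * (X - C t₀) ^ (2 + 3 * a + b) * A ^ 3 * B ∧
      S.eval t₀ = t₀ ^ 2 * (A.eval t₀ * B.eval t₀) ^ 2 *
        (-4 * (b - a) * (a + b - 1) + 8 * a * (b - a) + 3 * (b - a) ^ 2) := by
  set τ := X - C t₀ with hτ
  obtain ⟨W₁, hW₁⟩ : ∃ W₁, W₁ = ((b : ℂ[X]) * X * B + τ * (X * derivative B)) * A -
    B * ((a : ℂ[X]) * X * A + τ * (X * derivative A)) := ⟨_, rfl⟩
  obtain ⟨W, hW⟩ : ∃ W, W = X * derivative (τ ^ b * B) * (τ ^ a * A) -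
    τ ^ b * B * (X * derivative (τ ^ a * A)) := ⟨_, rfl⟩
  have hA := mul_X_mul_derivative_pow_mul t₀ a A
  have hB := mul_X_mul_derivative_pow_mul t₀ b B
  rw [← hτ] at hA hB
  -- Multiplying by τ avoids the truncated exponents a - 1 and b - 1.
  have hτW : τ * W = τ ^ (a + b) * W₁ := by
    rw [hW, hW₁, pow_add]
    linear_combination (τ ^ a * A) * hB - τ ^ b * B * hA
  have hDW : τ ^ 2 * (X * derivative W) =
      τ ^ (a + b) * (((a : ℂ[X]) + (b : ℂ[X]) - 1) * X * W₁ + τ * (X * derivative W₁)) := by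
    have h1 := mul_X_mul_derivative_pow_mul t₀ (a + b) W₁
    rw [← hτ, ← hτW, derivative_mul] at h1
    have h2 : derivative τ = 1 := by simp [hτ]
    rw [h2] at h1
    push_cast at h1
    linear_combination h1 - X * hτW
  have h3 := h W hW
  refine ⟨-4 * B * ((((a : ℂ[X]) + (b : ℂ[X]) - 1) * X * W₁ + τ * (X * derivative W₁)) * A -
      2 * W₁ * ((a : ℂ[X]) * X * A + τ * (X * derivative A))) + 3 * W₁ ^ 2,
    A ^ 2 * (-4 * C (v ^ 2) * B ^ 2 + 16 * X * B ^ 2), ?_, ?_⟩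
  · generalize hE : (X : ℂ[X]) * derivative (τ ^ a * A) = DA at *
    generalize hF : (X : ℂ[X]) * derivative W = DW at *
    have e : (τ ^ 2 * (-4 * (τ ^ b * B) * (DW * (τ ^ a * A) - 2 * W * DA) + 3 * W ^ 2)) =
      -4 * (τ ^ b * B) * ((τ ^ 2 * DW) * (τ ^ a * A) - 2 * (τ * W) * (τ * DA)) +
        3 * (τ * W) ^ 2 := by ring
    rw [h3, hDW, hτW, hA] at e
    simp only [pow_add, pow_mul'] at e ⊢
    linear_combination -e
  · have hτ0 : τ.eval t₀ = 0 := by simp [hτ]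
    simp only [eval_add, eval_mul, eval_sub, eval_pow, eval_X, hτ0, hW₁, eval_natCast, eval_one,
      eval_neg, eval_ofNat]
    ring

/-- At a pole of order a the term of order 2n - 2 is alone, and its coefficient n(4 - n) = -(a² +
4a) is nonzero. -/
theorem ProductEquation.eval_ne_zero {v t₀ : ℂ} {A B : ℂ[X]} (h : ProductEquation v A B)
    (hA : A ≠ 0) (hAB : IsCoprime A B) (ht : t₀ ≠ 0) : A.eval t₀ ≠ 0 := by
  intro h0
  obtain ⟨a, A', ha, rfl, hA'⟩ : ∃ (a : ℕ) (A' : ℂ[X]), a ≠ 0 ∧ A = (X - C t₀) ^ a * A' ∧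
      A'.eval t₀ ≠ 0 := by
    obtain ⟨A', h1, h2⟩ := exists_eq_pow_rootMultiplicity_mul_and_not_dvd A hA t₀
    exact ⟨_, A', ((rootMultiplicity_pos hA).mpr h0).ne', h1, fun h3 => h2 (dvd_iff_isRoot.mpr h3)⟩
  have hB : B.eval t₀ ≠ 0 := by
    intro h1
    obtain ⟨p, q, hpq⟩ := hAB
    have := congrArg (eval t₀) hpq
    simp [h1, ha] at this
  have h' : ProductEquation v ((X - C t₀) ^ a * A') ((X - C t₀) ^ 0 * B) := by simpa using h
  obtain ⟨S, R, h1, h2⟩ := h'.local_expansion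
  have h3 : S = (X - C t₀) ^ 2 * (R + 4 * (X - C t₀) ^ a * A' ^ 3 * B) := by
    apply mul_left_cancel₀ (pow_ne_zero (2 * a + 2 * 0) (X_sub_C_ne_zero t₀))
    rw [h1]
    simp only [pow_add, pow_mul', mul_zero, pow_zero]
    ring
  have h4 : S.eval t₀ = 0 := by rw [h3]; simp
  rw [h2] at h4
  have h5 : (-4 * ((0 : ℕ) - a) * (a + (0 : ℕ) - 1) + 8 * a * ((0 : ℕ) - a) +
      3 * ((0 : ℕ) - a) ^ 2 : ℂ) = -((a ^ 2 + 4 * a : ℕ) : ℂ) := by push_cast; ring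
  rw [h5] at h4
  refine mul_ne_zero (mul_ne_zero (pow_ne_zero 2 ht) (pow_ne_zero 2 (mul_ne_zero hA' hB)))
    (neg_ne_zero.mpr (Nat.cast_ne_zero.mpr ?_)) h4
  positivity

/-- For n = 1 the lowest coefficient n(4 - n) = 3 has no counterpart; for n ≥ 3 the term 4g is alone
at order n. Only n = 2 balances. -/
theorem ProductEquation.rootMultiplicity_eq_two {v t₀ : ℂ} {A B : ℂ[X]}
    (h : ProductEquation v A B) (hB : B ≠ 0) (hAB : IsCoprime A B) (ht : t₀ ≠ 0)
    (h0 : B.eval t₀ = 0) : B.rootMultiplicity t₀ = 2 := by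
  obtain ⟨B', hB1, hB2⟩ := exists_eq_pow_rootMultiplicity_mul_and_not_dvd B hB t₀
  have hB' : B'.eval t₀ ≠ 0 := fun h3 => hB2 (dvd_iff_isRoot.mpr h3)
  have hA : A.eval t₀ ≠ 0 := by
    intro h1
    obtain ⟨p, q, hpq⟩ := hAB
    have := congrArg (eval t₀) hpq
    simp [h1, h0] at this
  have hb : B.rootMultiplicity t₀ ≠ 0 := ((rootMultiplicity_pos hB).mpr h0).ne'
  generalize B.rootMultiplicity t₀ = b at *
  subst hB1
  have h' : ProductEquation v ((X - C t₀) ^ 0 * A) ((X - C t₀) ^ b * B') := by simpa using h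
  obtain ⟨S, R, h1, h2⟩ := h'.local_expansion
  obtain rfl | hb1 : b = 1 ∨ 2 ≤ b := by omega
  · exfalso
    have h3 : S = (X - C t₀) * (4 * A ^ 3 * B' + (X - C t₀) * R) := by
      apply mul_left_cancel₀ (pow_ne_zero 2 (X_sub_C_ne_zero t₀))
      linear_combination h1
    have h4 : S.eval t₀ = 0 := by rw [h3]; simp
    rw [h2] at h4
    simp [ht, hA, hB'] at h4
  · obtain ⟨c, rfl⟩ := Nat.exists_eq_add_of_le hb1
    rcases c with _ | c
    · rfl
    exfalso
    have h3 : (X - C t₀) ^ (c + 1) * (S - (X - C t₀) ^ 2 * R) = 4 * A ^ 3 * B' := by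
      apply mul_left_cancel₀ (pow_ne_zero (c + 5) (X_sub_C_ne_zero t₀))
      simp only [pow_add, pow_mul', mul_zero, pow_zero] at h1 ⊢
      linear_combination h1
    have h4 := congrArg (eval t₀) h3
    simp [hA, hB'] at h4

/-- At infinity all terms except 4g and 16tg² have at most the degree of g², so these two must
cancel each other. -/
theorem ProductEquation.natDegree_eq {v : ℂ} {A B : ℂ[X]} (h : ProductEquation v A B)
    (hA : A ≠ 0) (hB : B ≠ 0) : A.natDegree = B.natDegree + 1 := by
  obtain ⟨W, hW⟩ : ∃ W, W = X * derivative B * A - B * (X * derivative A) := ⟨_, rfl⟩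
  have h1 := h W hW
  have hWd : W.natDegree ≤ B.natDegree + A.natDegree := by
    rw [hW]
    refine (natDegree_sub_le_of_le (natDegree_mul_le_of_le (natDegree_X_mul_derivative_le B) le_rfl)
      (natDegree_mul_le_of_le le_rfl (natDegree_X_mul_derivative_le A))).trans ?_
    simp
  have hDA := natDegree_X_mul_derivative_le A
  have hDW := (natDegree_X_mul_derivative_le W).trans hWd
  set a := A.natDegree with ha
  set b := B.natDegree with hb
  have hl : (-4 * B * (X * derivative W * A - 2 * W * (X * derivative A)) + 3 * W ^ 2 +
      C (4 * v ^ 2) * (A ^ 2 * B ^ 2)).natDegree ≤ 2 * a + 2 * b := by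
    have e4 : (-4 : ℂ[X]).natDegree ≤ 0 := by
      rw [natDegree_neg]; exact (natDegree_ofNat 4).le
    have e2 : (2 : ℂ[X]).natDegree ≤ 0 := (natDegree_ofNat 2).le
    have e3 : (3 : ℂ[X]).natDegree ≤ 0 := (natDegree_ofNat 3).le
    refine natDegree_add_le_of_degree_le (natDegree_add_le_of_degree_le ?_ ?_) ?_
    · refine (natDegree_mul_le_of_le (natDegree_mul_le_of_le e4 hb.ge) (natDegree_sub_le_of_le
        (natDegree_mul_le_of_le hDW ha.ge) (natDegree_mul_le_of_le
        (natDegree_mul_le_of_le e2 hWd) hDA))).trans ?_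
      simp; omega
    · refine (natDegree_mul_le_of_le e3 (natDegree_pow_le_of_le 2 hWd)).trans ?_
      omega
    · refine (natDegree_C_mul_le _ _).trans ((natDegree_mul_le_of_le
        (natDegree_pow_le_of_le 2 ha.ge) (natDegree_pow_le_of_le 2 hb.ge)).trans ?_)
      omega
  have h2 : -4 * B * (X * derivative W * A - 2 * W * (X * derivative A)) + 3 * W ^ 2 +
      C (4 * v ^ 2) * (A ^ 2 * B ^ 2) = C 4 * (B * A ^ 3) + C 16 * (X * (A ^ 2 * B ^ 2)) := by
    rw [h1]
    simp only [C_mul, map_ofNat]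
    ring
  rw [h2] at hl
  have d1 : (B * A ^ 3).natDegree = b + 3 * a := by
    rw [natDegree_mul hB (pow_ne_zero 3 hA), natDegree_pow]
  have d2 : (X * (A ^ 2 * B ^ 2)).natDegree = 2 * a + 2 * b + 1 := by
    rw [natDegree_X_mul (mul_ne_zero (pow_ne_zero 2 hA) (pow_ne_zero 2 hB)),
      natDegree_mul (pow_ne_zero 2 hA) (pow_ne_zero 2 hB), natDegree_pow, natDegree_pow]
  have l1 : (B * A ^ 3).coeff (b + 3 * a) ≠ 0 := by
    rw [← d1, coeff_natDegree]
    simp [hA, hB]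
  have l2 : (X * (A ^ 2 * B ^ 2)).coeff (2 * a + 2 * b + 1) ≠ 0 := by
    rw [← d2, coeff_natDegree]
    simp [hA, hB]
  by_contra hne
  rcases lt_or_gt_of_ne hne with hlt | hlt
  · have := coeff_eq_zero_of_natDegree_lt (lt_of_le_of_lt hl (Nat.lt_succ_self _))
    rw [coeff_add, coeff_C_mul, coeff_C_mul,
      coeff_eq_zero_of_natDegree_lt (p := B * A ^ 3) (by omega)] at this
    simp only [mul_zero, zero_add, mul_eq_zero] at this
    exact this.elim (by norm_num) l2
  · have := coeff_eq_zero_of_natDegree_lt (lt_of_le_of_lt hl (show _ < b + 3 * a by omega))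
    rw [coeff_add, coeff_C_mul, coeff_C_mul,
      coeff_eq_zero_of_natDegree_lt (p := X * (A ^ 2 * B ^ 2)) (by omega)] at this
    simp only [mul_zero, add_zero, mul_eq_zero] at this
    exact this.elim (by norm_num) l1

/-- At t = 0 the operator θ multiplies the leading term t^(-m) of g by -m, so leading coefficients
give -4m² + 3m² = -4v². -/
theorem ProductEquation.sq_eq {v : ℂ} {m : ℕ} {A B : ℂ[X]}
    (h : ProductEquation v (X ^ m * A) B) (hm : m ≠ 0) (hA : A.eval 0 ≠ 0)
    (hB : B.eval 0 ≠ 0) : (m : ℂ) ^ 2 = 4 * v ^ 2 := by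
  obtain ⟨W₁, hW₁⟩ : ∃ W₁, W₁ = X * derivative B * A - B * ((m : ℂ[X]) * A + X * derivative A) := ⟨_, rfl⟩
  have h1 := h (X ^ m * W₁) (by rw [X_mul_derivative_X_pow_mul, hW₁]; ring)
  rw [X_mul_derivative_X_pow_mul, X_mul_derivative_X_pow_mul] at h1
  have h2 : -4 * B * (((m : ℂ[X]) * W₁ + X * derivative W₁) * A - 2 * W₁ * ((m : ℂ[X]) * A + X * derivative A)) +
      3 * W₁ ^ 2 = A ^ 2 * (-4 * C (v ^ 2) * B ^ 2 + 4 * B * (X ^ m * A) + 16 * X * B ^ 2) := by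
    apply mul_left_cancel₀ (pow_ne_zero 2 (pow_ne_zero m (X_ne_zero (R := ℂ))))
    linear_combination h1
  have h3 := congrArg (eval 0) h2
  simp only [eval_add, eval_mul, eval_sub, eval_pow, eval_X, hW₁, eval_natCast, eval_C,
      eval_neg, eval_ofNat, zero_pow hm] at h3
  have h4 : (A.eval 0 * B.eval 0) ^ 2 ≠ 0 := pow_ne_zero 2 (mul_ne_zero hA hB)
  apply mul_left_cancel₀ h4
  linear_combination -h3

/-- Away from 0 there are no poles and only double zeros, so A is a constant times X^m and deg B is
even. Then m = deg B + 1 is odd, and v = ±m/2. -/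
theorem ProductEquation.exists_int {v : ℂ} {A B : ℂ[X]} (h : ProductEquation v A B)
    (hA : A ≠ 0) (hB : B ≠ 0) (hAB : IsCoprime A B) : ∃ n : ℤ, v = 1 / 2 + n := by
  have hdeg := h.natDegree_eq hA hB
  obtain ⟨A', hA1, hA2⟩ := exists_eq_pow_rootMultiplicity_mul_and_not_dvd A hA 0
  simp only [C_0, sub_zero] at hA1 hA2
  have hA0 : A'.eval 0 ≠ 0 := fun h0 => hA2 (X_dvd_iff.mpr (by rwa [coeff_zero_eq_eval_zero]))
  have hA'0 : A' ≠ 0 := by rintro rfl; simp at hA0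
  have hA'd : A'.natDegree = 0 := by
    by_contra hd
    obtain ⟨r, hr⟩ := IsAlgClosed.exists_root A' (fun hd' => hd (natDegree_eq_of_degree_eq_some hd'))
    have hr0 : r ≠ 0 := by rintro rfl; exact hA0 hr
    refine h.eval_ne_zero hA hAB hr0 ?_
    rw [hA1, eval_mul, hr.eq_zero, mul_zero]
  have hmd : A.natDegree = A.rootMultiplicity 0 := by
    conv_lhs => rw [hA1]
    rw [natDegree_mul (pow_ne_zero _ X_ne_zero) hA'0, natDegree_X_pow, hA'd, add_zero]
  generalize A.rootMultiplicity 0 = m at *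
  have hm : m ≠ 0 := by omega
  have hB0 : B.eval 0 ≠ 0 := by
    intro h1
    obtain ⟨p, q, hpq⟩ := hAB
    have := congrArg (eval 0) hpq
    simp [h1, hA1, hm] at this
  have heven : Even B.natDegree := by
    rw [(IsAlgClosed.splits B).natDegree_eq_card_roots, ← Multiset.toFinset_sum_count_eq]
    refine Finset.even_sum _ fun r hr => ?_
    rw [count_roots]
    have hr' : B.eval r = 0 := by
      rw [Multiset.mem_toFinset, mem_roots hB] at hr
      exact hr
    rw [h.rootMultiplicity_eq_two hB hAB (by rintro rfl; exact hB0 hr') hr']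
    exact even_two
  obtain ⟨e, he⟩ := heven
  have hsq := ProductEquation.sq_eq (hA1 ▸ h) hm hA0 hB0
  have hme : m = 2 * e + 1 := by omega
  have hfac : (v - m / 2) * (v + m / 2) = 0 := by linear_combination -hsq / 4
  rcases mul_eq_zero.mp hfac with h1 | h1
  · exact ⟨e, by rw [hme] at h1; push_cast at h1 ⊢; linear_combination h1⟩
  · exact ⟨-e - 1, by rw [hme] at h1; push_cast at h1 ⊢; linear_combination h1⟩

end PainleveThree

/-! ### The field ℂ(τ) with τ d/dτ, and the absence of invariant polynomials over it. -/

namespace PainleveThree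

open Polynomial
open scoped Differential LaurentSeries

section Eval

theorem deriv_div {L : Type*} [Field L] [Differential L] (a b : L) :
    (a / b)′ = (a′ * b - a * b′) / b ^ 2 := by
  rw [Derivation.leibniz_div, smul_eq_mul, smul_eq_mul, smul_eq_mul, div_eq_inv_mul]
  ring

variable {L : Type*} [Field L] [Differential L] {ι : ℂ →+* L} {τ : L}

theorem deriv_eval₂_const (hc : ∀ c, (ι c)′ = 0) (hτ : τ′ = τ) (A : ℂ[X]) :
    (A.eval₂ ι τ)′ = (X * derivative A).eval₂ ι τ := by
  induction A using Polynomial.induction_on' with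
  | add p q hp hq => simp only [eval₂_add, map_add, hp, hq, mul_add]
  | monomial n a =>
    simp only [eval₂_monomial, Derivation.leibniz, Derivation.leibniz_pow, hc, hτ,
      derivative_monomial, eval₂_mul, eval₂_X, map_mul, map_natCast, smul_eq_mul, nsmul_eq_mul]
    rcases n with _ | n
    · simp
    · rw [Nat.add_sub_cancel, pow_succ]; ring

/-- An algebraic τ would lie in the algebraically closed field ℂ of constants, contrary to τ′ = τ ≠
0. -/
theorem eval₂_ne_zero_of_deriv (hc : ∀ c, (ι c)′ = 0) (hτ : τ′ = τ) (hτ0 : τ ≠ 0) {A : ℂ[X]}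
    (hA : A ≠ 0) : A.eval₂ ι τ ≠ 0 := by
  intro h
  let _ := ι.toAlgebra
  have hint : IsIntegral ℂ τ := IsAlgebraic.isIntegral ⟨A, hA, h⟩
  obtain ⟨c, hc'⟩ := minpoly.mem_range_of_degree_eq_one ℂ τ
    (IsAlgClosed.degree_eq_one_of_irreducible ℂ (minpoly.irreducible hint))
  exact hτ0 (by rw [← hτ, ← hc']; exact hc c)

theorem eval₂_injective_of_deriv (hc : ∀ c, (ι c)′ = 0) (hτ : τ′ = τ) (hτ0 : τ ≠ 0) :
    Function.Injective (eval₂RingHom ι τ) := by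
  rw [injective_iff_map_eq_zero]
  intro A hA
  by_contra h
  exact eval₂_ne_zero_of_deriv hc hτ hτ0 h hA

end Eval

/-- `F` is the field `ℂ(τ)` with the derivation `τ d/dτ`. -/
structure IsEulerField {F : Type*} [Field F] [Differential F] (ι : ℂ →+* F) (τ : F) : Prop where
  deriv_const : ∀ c, (ι c)′ = 0
  deriv_gen : τ′ = τ
  gen_ne_zero : τ ≠ 0
  exists_eq_div : ∀ x : F, ∃ A B : ℂ[X], x = A.eval₂ ι τ / B.eval₂ ι τ

namespace IsEulerField

variable {F : Type*} [Field F] [Differential F] {ι : ℂ →+* F} {τ : F}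

theorem eval₂_ne_zero (h : IsEulerField ι τ) {A : ℂ[X]} (hA : A ≠ 0) : A.eval₂ ι τ ≠ 0 :=
  eval₂_ne_zero_of_deriv h.deriv_const h.deriv_gen h.gen_ne_zero hA

theorem eval₂_injective (h : IsEulerField ι τ) : Function.Injective (eval₂RingHom ι τ) :=
  eval₂_injective_of_deriv h.deriv_const h.deriv_gen h.gen_ne_zero

theorem isFractionRing (h : IsEulerField ι τ) :
    letI := (eval₂RingHom ι τ).toAlgebra
    IsFractionRing ℂ[X] F := by
  let _ := (eval₂RingHom ι τ).toAlgebra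
  have : FaithfulSMul ℂ[X] F := (faithfulSMul_iff_algebraMap_injective _ _).mpr h.eval₂_injective
  exact IsFractionRing.of_field ℂ[X] F fun z => h.exists_eq_div z

theorem exists_coprime_eq_div (h : IsEulerField ι τ) (x : F) :
    ∃ A B : ℂ[X], B ≠ 0 ∧ IsCoprime A B ∧ x = A.eval₂ ι τ / B.eval₂ ι τ := by
  let _ := (eval₂RingHom ι τ).toAlgebra
  have := h.isFractionRing
  obtain ⟨A, B, hAB, hx⟩ := IsFractionRing.exists_reduced_fraction (A := ℂ[X]) x
  refine ⟨A, B, nonZeroDivisors.ne_zero B.2, hAB.isCoprime, ?_⟩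
  rw [← hx, IsFractionRing.mk'_eq_div]
  rfl

/-- This is expansion at infinity. The series s⁻² also satisfies τ′ = τ ≠ 0, so it is transcendental
over ℂ and the substitution extends to fractions. -/
theorem exists_laurent (h : IsEulerField ι τ) :
    ∃ φ : F →+* LaurentSeries ℂ, (∀ c, φ (ι c) = HahnSeries.C c) ∧
      φ τ = HahnSeries.single (-2) 1 ∧ ∀ x, φ (x′) = (φ x)′ := by
  have hc : ∀ c : ℂ, (HahnSeries.C c : LaurentSeries ℂ)′ = 0 := by
    intro c
    ext n
    rw [coeff_eulerLaurent, HahnSeries.C_apply, HahnSeries.coeff_single]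
    split_ifs with hn
    · simp [hn]
    · simp
  have hτ : (HahnSeries.single (-2) 1 : LaurentSeries ℂ)′ = HahnSeries.single (-2) 1 := by
    ext n
    rw [coeff_eulerLaurent, HahnSeries.coeff_single]
    split_ifs with hn
    · simp [hn]
    · simp
  have hτ0 : (HahnSeries.single (-2) 1 : LaurentSeries ℂ) ≠ 0 := by simp
  let _ := (eval₂RingHom ι τ).toAlgebra
  have := h.isFractionRing
  have hinj := eval₂_injective_of_deriv hc hτ hτ0
  let φ : F →+* LaurentSeries ℂ := IsFractionRing.lift hinj
  have hφ : ∀ A : ℂ[X], φ (A.eval₂ ι τ) =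
      A.eval₂ HahnSeries.C (HahnSeries.single (-2) 1) :=
    fun A => IsFractionRing.lift_algebraMap hinj A
  refine ⟨φ, fun c => by simpa using hφ (C c), by simpa using hφ X, fun x => ?_⟩
  obtain ⟨A, B, hB, -, rfl⟩ := h.exists_coprime_eq_div x
  rw [deriv_div, map_div₀, map_div₀, deriv_div, deriv_eval₂_const h.deriv_const h.deriv_gen,
    deriv_eval₂_const h.deriv_const h.deriv_gen]
  simp only [map_mul, map_sub, map_pow, hφ]
  rw [deriv_eval₂_const hc hτ, deriv_eval₂_const hc hτ]

end IsEulerField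

theorem map_riccatiDeriv {F L : Type*} [Field F] [Field L] [Differential F] [Differential L]
    (φ : F →+* L) (hφ : ∀ x, φ (x′) = (φ x)′) (v τ : F) (P : F[X]) :
    (riccatiDeriv v τ P).map φ = riccatiDeriv (φ v) (φ τ) (P.map φ) := by
  rw [riccatiDeriv_apply, riccatiDeriv_apply, Polynomial.map_add, Polynomial.map_mul, derivative_map]
  congr 1
  · ext n
    simp [hφ]
  · simp

namespace IsEulerField

variable {F : Type*} [Field F] [Differential F] {ι : ℂ →+* F} {τ : F}

theorem charZero (_ : IsEulerField ι τ) : CharZero F := charZero_of_injective_ringHom ι.injective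

/-- Over Laurent series P may become reducible, but separability keeps it squarefree, which is all
the degree bound needs. -/
theorem natDegree_le_two (h : IsEulerField ι τ) {v : ℂ} {P : F[X]} (hm : P.Monic)
    (hP : Irreducible P) (hd : P ∣ riccatiDeriv (ι v) τ P) : P.natDegree ≤ 2 := by
  have := h.charZero
  obtain ⟨c, hc⟩ := riccatiDeriv_eq_of_dvd hm hd
  obtain ⟨φ, hφC, hφτ, hφ⟩ := h.exists_laurent
  refine le_two_of_squarefree_invariant v (c := φ c) (P := P.map φ)
    (hP.separable.map (f := φ)).squarefree ?_
  rw [← hφC v, ← hφτ, ← map_riccatiDeriv φ hφ, hc]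
  simp

theorem no_rational_solution (h : IsEulerField ι τ) {v : ℂ} {y : F} :
    y′ ≠ y ^ 2 + ι v * y + τ := by
  intro hy
  obtain ⟨A, B, hB, -, rfl⟩ := h.exists_coprime_eq_div y
  refine not_rational_riccati hB v (A := A) (h.eval₂_injective ?_)
  have hB' := h.eval₂_ne_zero hB
  rw [Derivation.leibniz_div, deriv_eval₂_const h.deriv_const h.deriv_gen,
    deriv_eval₂_const h.deriv_const h.deriv_gen] at hy
  simp only [smul_eq_mul] at hy
  field_simp at hy
  simp only [coe_eval₂RingHom, eval₂_add, eval₂_sub, eval₂_mul, eval₂_pow, eval₂_X, eval₂_C] at hy ⊢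
  linear_combination hy

/-- Here s and p are the sum and product of the roots of an invariant quadratic. Its discriminant Δ
satisfies Δ′ = 2(s + v)Δ; differentiating once more and eliminating s and p gives `ProductEquation`
for 1/Δ. -/
theorem exists_half_int_of_quadratic (h : IsEulerField ι τ) {v : ℂ} {s p : F}
    (hs : s′ = s ^ 2 + ι v * s - 2 * p + 2 * τ) (hp : p′ = (s + 2 * ι v) * p + τ * s)
    (hΔ : s ^ 2 - 4 * p ≠ 0) : ∃ n : ℤ, v = 1 / 2 + n := by
  obtain ⟨B, A, hA, hBA, hg⟩ := h.exists_coprime_eq_div (s ^ 2 - 4 * p)⁻¹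
  have hA' := h.eval₂_ne_zero hA
  have hB : B ≠ 0 := by
    rintro rfl
    rw [eval₂_zero, zero_div] at hg
    exact inv_ne_zero hΔ hg
  have hab : A.eval₂ ι τ = B.eval₂ ι τ * (s ^ 2 - 4 * p) := by
    field_simp at hg
    linear_combination hg
  have h4 : (4 : F)′ = 0 := by
    have := h.deriv_const 4
    rwa [map_ofNat] at this
  have hΔ' : (s ^ 2 - 4 * p)′ = 2 * (s + ι v) * (s ^ 2 - 4 * p) := by
    simp only [map_sub, Derivation.leibniz, Derivation.leibniz_pow, h4, hs, hp, smul_eq_mul,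
      nsmul_eq_mul]
    push_cast
    ring
  refine ProductEquation.exists_int (A := A) (B := B) (fun W hW => h.eval₂_injective ?_) hA hB
    hBA.symm
  have hDA := deriv_eval₂_const h.deriv_const h.deriv_gen A
  have hDB := deriv_eval₂_const h.deriv_const h.deriv_gen B
  have hDW := deriv_eval₂_const h.deriv_const h.deriv_gen W
  have hWe := congrArg (eval₂RingHom ι τ) hW
  simp only [coe_eval₂RingHom, eval₂_sub, eval₂_mul] at hWe
  rw [← eval₂_mul, ← hDB, ← eval₂_mul, ← hDA] at hWe
  have hrel : (B.eval₂ ι τ)′ * A.eval₂ ι τ - B.eval₂ ι τ * (A.eval₂ ι τ)′ =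
      -2 * (s + ι v) * (A.eval₂ ι τ * B.eval₂ ι τ) := by
    rw [hab, Derivation.leibniz, hΔ', smul_eq_mul, smul_eq_mul]
    ring
  have hw : W.eval₂ ι τ = -2 * ((s + ι v) * (A.eval₂ ι τ * B.eval₂ ι τ)) := by
    rw [hWe, hrel, mul_assoc]
  have h2 : (-2 : F)′ = 0 := by
    have := h.deriv_const (-2)
    rwa [map_neg, map_ofNat] at this
  have hDw : (W.eval₂ ι τ)′ = -2 * ((s ^ 2 + ι v * s - 2 * p + 2 * τ) *
      (A.eval₂ ι τ * B.eval₂ ι τ) + (s + ι v) * ((A.eval₂ ι τ)′ * B.eval₂ ι τ +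
        A.eval₂ ι τ * (B.eval₂ ι τ)′)) := by
    rw [hw]
    simp only [Derivation.leibniz, map_add, hs, h.deriv_const, h2, smul_eq_mul]
    ring
  have e : ∀ n : ℕ, [n.AtLeastTwo] → eval₂ ι τ (ofNat(n) : ℂ[X]) = (ofNat(n) : F) := fun n _ =>
    map_ofNat (eval₂RingHom ι τ) n
  simp only [coe_eval₂RingHom, eval₂_add, eval₂_sub, eval₂_mul, eval₂_pow, eval₂_neg, eval₂_C, e,
    map_pow]
  rw [← eval₂_mul, ← hDW, ← eval₂_mul, ← hDA, hDw, hw, eval₂_X]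
  linear_combination 8 * (s + ι v) * (A.eval₂ ι τ * B.eval₂ ι τ) * hrel -
    4 * B.eval₂ ι τ * A.eval₂ ι τ ^ 2 * hab

/-- Away from half-integral parameters, the Riccati equation has no invariant polynomial. -/
theorem not_dvd_riccatiDeriv_of_irreducible (h : IsEulerField ι τ) {v : ℂ}
    (hv : ∀ n : ℤ, v ≠ 1 / 2 + n) {P : F[X]} (hm : P.Monic) (hP : Irreducible P) :
    ¬ P ∣ riccatiDeriv (ι v) τ P := by
  intro hd
  have := h.charZero
  have hdeg := h.natDegree_le_two hm hP hd
  obtain ⟨c, hc⟩ := riccatiDeriv_eq_of_dvd hm hd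
  have hpos : P.natDegree ≠ 0 := fun h0 => hP.not_isUnit (by
    rw [hm.natDegree_eq_zero.mp h0]; exact isUnit_one)
  have hlead := hm.coeff_natDegree
  -- The coefficient in degree deg P determines c; the lower ones are then differential equations
  -- for the coefficients of P.
  have c0 := congrArg (fun Q => Q.coeff 0) hc
  have c1 := congrArg (fun Q => Q.coeff 1) hc
  have c2 := congrArg (fun Q => Q.coeff 2) hc
  have c3 : P.coeff 3 = 0 := coeff_eq_zero_of_natDegree_lt (by omega)
  simp only [add_mul, mul_assoc, coeff_add, coeff_C_mul, coeff_riccatiDeriv_zero, coeff_X_mul_zero] at c0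
  simp only [add_mul, mul_assoc, coeff_add, coeff_C_mul, coeff_X_mul,
    coeff_riccatiDeriv_succ (k := 0)] at c1
  simp only [add_mul, mul_assoc, coeff_add, coeff_C_mul, coeff_X_mul,
    coeff_riccatiDeriv_succ (k := 1)] at c2
  simp only [zero_add, Nat.reduceAdd, c3] at c1 c2
  obtain h1 | h2 : P.natDegree = 1 ∨ P.natDegree = 2 := by omega
  · rw [h1] at hlead c0 c1
    have h2 : P.coeff 2 = 0 := coeff_eq_zero_of_natDegree_lt (by omega)
    simp only [hlead, h2, Derivation.map_one_eq_zero] at c0 c1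
    push_cast at c0 c1
    refine h.no_rational_solution (v := v) (y := -P.coeff 0) ?_
    rw [map_neg]
    linear_combination -c0 + P.coeff 0 * c1
  · rw [h2] at hlead c0 c1 c2
    simp only [hlead, Derivation.map_one_eq_zero] at c0 c1 c2
    push_cast at c0 c1 c2
    have hΔ : (-P.coeff 1) ^ 2 - 4 * P.coeff 0 ≠ 0 := by
      intro hΔ
      have hsq : P = (X + C (P.coeff 1 / 2)) * (X + C (P.coeff 1 / 2)) := by
        have h0 : P.coeff 0 = (P.coeff 1 / 2) ^ 2 := by linear_combination -hΔ / 4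
        conv_lhs => rw [P.as_sum_range_C_mul_X_pow, h2]
        simp only [Finset.sum_range_succ, Finset.sum_range_zero, hlead, h0]
        have hC : C (P.coeff 1) = 2 * C (P.coeff 1 / 2) := by
          rw [← map_ofNat C, ← C_mul]
          congr 1
          ring
        rw [hC]
        simp only [C_pow, C_1]
        ring
      have hX := hP.squarefree _ ⟨1, by rw [mul_one]; exact hsq⟩
      exact not_isUnit_X_add_C _ hX
    obtain ⟨n, hn⟩ := h.exists_half_int_of_quadratic (v := v) (s := -P.coeff 1) (p := P.coeff 0)
      (by rw [map_neg]; linear_combination -c1 + P.coeff 1 * c2)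
      (by linear_combination c0 - P.coeff 0 * c2) hΔ
    exact hv n hn

theorem not_dvd_riccatiDeriv (h : IsEulerField ι τ) {v : ℂ}
    (hv : ∀ n : ℤ, v ≠ 1 / 2 + n) {P : F[X]} (hP0 : P ≠ 0) (hP : ¬ IsUnit P) :
    ¬ P ∣ riccatiDeriv (ι v) τ P := by
  intro hd
  have := h.charZero
  obtain ⟨Q, hQm, hQi, hQd⟩ := exists_irreducible_dvd_derivation (riccatiDeriv (ι v) τ) hP0 hP hd
  exact h.not_dvd_riccatiDeriv_of_irreducible hv hQm hQi hQd

end IsEulerField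

end PainleveThree

/-! ### Algebraic independence of two Riccati solutions. -/

namespace PainleveThree

open Polynomial
open scoped Differential

/-- The restriction of a derivation to a stable intermediate field. -/
@[reducible]
noncomputable def differentialOfStable {F U : Type*} [Field F] [Field U] [Differential U]
    [Algebra F U] (M : IntermediateField F U) (hM : ∀ x ∈ M, x′ ∈ M) : Differential M :=
  differentialOfLeibniz
    { toFun := fun x => ⟨(x : U)′, hM x x.2⟩
      map_zero' := Subtype.ext (by simp)
      map_add' := fun a b => Subtype.ext (by simp) }
    fun a b => Subtype.ext (by simp)

theorem differentialAlgebra_of_stable {F U : Type*} [Field F] [Field U] [Differential U]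
    [Algebra F U] (M : IntermediateField F U) (hM : ∀ x ∈ M, x′ ∈ M) :
    letI := differentialOfStable M hM
    DifferentialAlgebra M U :=
  letI := differentialOfStable M hM
  ⟨fun _ => rfl⟩

/-- An inhomogeneous linear equation with an algebraic solution has a rational one, namely the
averaged trace. -/
theorem exists_solution_of_isAlgebraic {M A : Type*} [Field M] [Field A] [CharZero M]
    [Differential M] [Differential A] [Algebra M A] [DifferentialAlgebra M A] {α β : M} {w : A}
    (hw : IsAlgebraic M w) (h : w′ = algebraMap M A α * w + algebraMap M A β) :
    ∃ x : M, x′ = α * x + β := by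
  have hint := hw.isIntegral
  have hm := minpoly.monic hint
  set P := minpoly M w with hP
  obtain ⟨n, hn⟩ : ∃ n, P.natDegree = n + 1 :=
    Nat.exists_eq_add_one.mpr (minpoly.natDegree_pos hint)
  set δ := Differential.implicitDeriv (C α * X + C β) with hδ
  have hcoeff : ∀ k, (δ P).coeff k =
      (P.coeff k)′ + α * (k * P.coeff k) + β * (P.coeff (k + 1) * (k + 1)) := by
    intro k
    simp only [hδ, Differential.implicitDeriv, Derivation.add_apply, Derivation.smul_apply,
      Derivation.restrictScalars_apply, derivative'_apply, smul_eq_mul, add_mul, coeff_add,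
      Differential.coeff_mapCoeffs, mul_assoc, coeff_C_mul, coeff_X_mul_derivative,
      coeff_derivative]
    ring
  have hroot : aeval w (δ P) = 0 := by
    rw [← Differential.deriv_aeval_eq_implicitDeriv w _ (by simpa using h), hP, minpoly.aeval,
      map_zero]
  have hlead : P.coeff (n + 1) = 1 := hn ▸ hm.coeff_natDegree
  -- Both δP and (n + 1)αP have leading coefficient (n + 1)α, so their difference vanishes at w with
  -- degree below that of the minimal polynomial.
  have hzero : δ P - C ((n + 1) * α) * P = 0 := by
    refine eq_zero_of_dvd_of_natDegree_lt (dvd_sub (minpoly.dvd M w hroot) (dvd_mul_left _ _)) ?_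
    rw [← hP, hn, Nat.lt_succ_iff, natDegree_le_iff_coeff_eq_zero]
    intro N hN
    rw [coeff_sub, coeff_C_mul, hcoeff]
    rcases (Nat.succ_le_of_lt hN).eq_or_lt with rfl | hN'
    · rw [Nat.succ_eq_add_one, hlead, coeff_eq_zero_of_natDegree_lt (n := n + 1 + 1) (by omega)]
      simp
      ring
    · rw [coeff_eq_zero_of_natDegree_lt (n := N) (by omega),
        coeff_eq_zero_of_natDegree_lt (n := N + 1) (by omega)]
      simp
  have hn0 := congrArg (fun Q => Q.coeff n) hzero
  simp only [coeff_sub, coeff_C_mul, hcoeff, coeff_zero, hlead] at hn0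
  have hne : ((n + 1 : ℕ) : M) ≠ 0 := Nat.cast_ne_zero.mpr n.succ_ne_zero
  -- The mean of the conjugates of w.
  refine ⟨-P.coeff n / (n + 1 : ℕ), ?_⟩
  rw [deriv_div, map_neg, Derivation.map_natCast]
  field_simp
  push_cast
  linear_combination -((n : M) + 1) * hn0

namespace IsEulerField

variable {F : Type*} [Field F] [Differential F] {ι : ℂ →+* F} {τ : F}
  {U : Type*} [Field U] [Differential U] [Algebra F U] [DifferentialAlgebra F U]

theorem transcendental (h : IsEulerField ι τ) {v : ℂ} (hv : ∀ n : ℤ, v ≠ 1 / 2 + n) {y : U}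
    (hy : y′ = y ^ 2 + algebraMap F U (ι v) * y + algebraMap F U τ) : Transcendental F y := by
  intro halg
  have hint := halg.isIntegral
  refine h.not_dvd_riccatiDeriv_of_irreducible hv (minpoly.monic hint) (minpoly.irreducible hint)
    (minpoly.dvd F y ?_)
  rw [← deriv_aeval_eq_aeval_riccatiDeriv hy, minpoly.aeval, map_zero]

/-- Comparing coefficients in degree deg A + 1 gives (deg A + 2) · lead(A) = 0, so A = 0, which is
not a solution. -/
theorem no_polynomial_solution (h : IsEulerField ι τ) {v : F} (A : F[X]) :
    riccatiDeriv v τ A ≠ -(2 * X + C v) * A + 1 := by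
  intro hA
  have := h.charZero
  have h1 := congrArg (fun Q => Q.coeff (A.natDegree + 1)) hA
  have e : -(2 * X + C v) * A + 1 = C (-2) * (X * A) - C v * A + 1 := by
    rw [C_neg, map_ofNat]
    ring
  simp only [e, coeff_riccatiDeriv_succ, coeff_add, coeff_sub, coeff_C_mul, coeff_X_mul, coeff_one,
    coeff_eq_zero_of_natDegree_lt (show A.natDegree < A.natDegree + 1 by omega),
    coeff_eq_zero_of_natDegree_lt (show A.natDegree < A.natDegree + 2 by omega)] at h1
  have h2 : ((A.natDegree + 2 : ℕ) : F) * A.leadingCoeff = 0 := by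
    rw [leadingCoeff]
    push_cast
    simpa [add_mul, ← eq_neg_iff_add_eq_zero] using h1
  have h3 : A = 0 := leadingCoeff_eq_zero.mp
    ((mul_eq_zero.mp h2).resolve_left (Nat.cast_ne_zero.mpr (by omega)))
  rw [h3] at hA
  simp at hA

/-- In lowest terms A/B the equation forces B to divide its own derivative, so B is constant and the
polynomial case applies. -/
theorem no_rational_function_solution (h : IsEulerField ι τ) {v : ℂ}
    (hv : ∀ n : ℤ, v ≠ 1 / 2 + n) {y : U}
    (hy : y′ = y ^ 2 + algebraMap F U (ι v) * y + algebraMap F U τ) (r s : F[X]) (w : U)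
    (hw : w = aeval y r / aeval y s) : w′ ≠ -(2 * y + algebraMap F U (ι v)) * w + 1 := by
  intro hw'
  have htr := h.transcendental hv hy
  have hinj := transcendental_iff_injective.mp htr
  have hs : s ≠ 0 := by
    rintro rfl
    simp only [map_zero, div_zero] at hw
    simp [hw] at hw'
  obtain ⟨B, A, g, hBA, rfl, rfl⟩ := UniqueFactorizationMonoid.exists_reduced_factors s hs r
  have hB : B ≠ 0 := right_ne_zero_of_mul hs
  have hne : ∀ {Q : F[X]}, Q ≠ 0 → aeval y Q ≠ 0 := fun hQ h0 => htr ⟨_, hQ, h0⟩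
  have hg := hne (left_ne_zero_of_mul hs)
  have hB' := hne hB
  rw [map_mul, map_mul, mul_div_mul_left _ _ hg] at hw
  have hδ := deriv_aeval_eq_aeval_riccatiDeriv hy
  have heq : riccatiDeriv (ι v) τ A * B - A * riccatiDeriv (ι v) τ B =
      -(2 * X + C (ι v)) * A * B + B ^ 2 := by
    apply hinj
    rw [hw, deriv_div, hδ, hδ] at hw'
    field_simp at hw'
    simp only [map_sub, map_add, map_mul, map_neg, map_pow, aeval_X, aeval_C, map_ofNat]
    linear_combination hw'
  have hdvd : B ∣ riccatiDeriv (ι v) τ B := by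
    refine hBA.isCoprime.dvd_of_dvd_mul_left ?_
    exact ⟨riccatiDeriv (ι v) τ A + (2 * X + C (ι v)) * A - B, by linear_combination -heq⟩
  have hu : IsUnit B := by
    by_contra hu
    exact h.not_dvd_riccatiDeriv hv hB hu hdvd
  obtain ⟨b, hb, rfl⟩ := Polynomial.isUnit_iff.mp hu
  refine h.no_polynomial_solution (v := ι v) (C b⁻¹ * A) (hinj ?_)
  have hwA : w = aeval y (C b⁻¹ * A) := by
    rw [hw, map_mul, aeval_C, aeval_C, map_inv₀, div_eq_inv_mul]
  rw [← hδ, ← hwA, hw']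
  simp only [map_add, map_mul, map_neg, aeval_X, aeval_C, map_ofNat, map_one, hwA]

theorem transcendental_over_adjoin (h : IsEulerField ι τ) {v : ℂ} (hv : ∀ n : ℤ, v ≠ 1 / 2 + n)
    {y z : U} (hy : y′ = y ^ 2 + algebraMap F U (ι v) * y + algebraMap F U τ)
    (hz : z′ = z ^ 2 + algebraMap F U (ι v) * z + algebraMap F U τ) (hyz : y ≠ z) :
    Transcendental F⟮y⟯ z := by
  intro halg
  have hM : ∀ x ∈ F⟮y⟯, x′ ∈ F⟮y⟯ := by
    intro x hx
    obtain ⟨r, s, rfl⟩ := (IntermediateField.mem_adjoin_simple_iff F x).mp hx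
    have hmem : ∀ Q : F[X], aeval y Q ∈ F⟮y⟯ := fun Q =>
      (IntermediateField.mem_adjoin_simple_iff F _).mpr ⟨Q, 1, by simp⟩
    rw [deriv_div, deriv_aeval_eq_aeval_riccatiDeriv hy, deriv_aeval_eq_aeval_riccatiDeriv hy]
    exact div_mem (sub_mem (mul_mem (hmem _) (hmem _)) (mul_mem (hmem _) (hmem _)))
      (pow_mem (hmem _) 2)
  let _ := differentialOfStable F⟮y⟯ hM
  have := differentialAlgebra_of_stable F⟮y⟯ hM
  have := h.charZero
  have : CharZero F⟮y⟯ := charZero_of_injective_algebraMap (algebraMap F F⟮y⟯).injective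
  let y' : F⟮y⟯ := IntermediateField.AdjoinSimple.gen F y
  have hy' : algebraMap F⟮y⟯ U y' = y := rfl
  have hyz' : y - z ≠ 0 := sub_ne_zero.mpr hyz
  -- From (y - z)′ = (y - z)(y + z + v), writing z = y - w⁻¹ with w = (y - z)⁻¹ makes the equation
  -- linear over F(y).
  have hw : ((y - z)⁻¹)′ = algebraMap F⟮y⟯ U (-(2 * y' + algebraMap F F⟮y⟯ (ι v))) * (y - z)⁻¹ +
      algebraMap F⟮y⟯ U 1 := by
    rw [← one_div, deriv_div, Derivation.map_one_eq_zero, map_sub, hy, hz]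
    simp only [map_neg, map_add, map_mul, map_ofNat, hy', map_one,
      ← IsScalarTower.algebraMap_apply F F⟮y⟯ U]
    field_simp
    ring
  have hyalg : IsAlgebraic F⟮y⟯ y := isAlgebraic_algebraMap y'
  obtain ⟨x, hx⟩ := exists_solution_of_isAlgebraic (hyalg.sub halg).inv hw
  obtain ⟨r, s, hrs⟩ := (IntermediateField.mem_adjoin_simple_iff F (x : U)).mp x.2
  refine h.no_rational_function_solution hv hy r s x hrs ?_
  have hx' := congrArg (algebraMap F⟮y⟯ U) hx
  rw [← DifferentialAlgebra.deriv_algebraMap] at hx'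
  simp only [map_neg, map_add, map_mul, map_ofNat, hy', map_one,
      ← IsScalarTower.algebraMap_apply F F⟮y⟯ U] at hx'
  exact hx'

end IsEulerField

end PainleveThree

/-! ### Relations among the Bäcklund transformations. -/

namespace PainleveThree

section Orbit

variable {U : Type*} [Field U] [Algebra ℂ U]

/-- The composite of `backlundNeg` and `backlundInv`; it sends the parameters `(v₁, v₂)` to
`(1 - v₂, 1 - v₁)` and preserves the Riccati varieties. -/
noncomputable def backlundMu (t : U) (v₁ v₂ : ℂ) (P : U × U) : U × U :=
  (-t / P.1, 1 + P.1 / t * (P.1 * (P.2 - 1) + algebraMap ℂ U ((v₁ - v₂) / 2)))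

theorem charZero_of_complexAlgebra (U : Type*) [Field U] [Algebra ℂ U] : CharZero U :=
  charZero_of_injective_algebraMap (algebraMap ℂ U).injective

theorem backlundS_backlundS (v₁ v₂ : ℂ) (P : U × U) :
    backlundS v₂ v₁ (backlundS v₁ v₂ P) = P := by
  ext
  · simp only [backlundS, map_sub]
    ring
  · rfl

theorem backlundS_self (v : ℂ) (P : U × U) : backlundS v v P = P := by
  ext <;> simp [backlundS]

theorem backlundInv_backlundInv {t : U} (ht : t ≠ 0) (v₁ v₂ : ℂ) {P : U × U} (hP : P.1 ≠ 0) :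
    backlundInv t (v₂ + 1) (v₁ - 1) (backlundInv t v₁ v₂ P) = P := by
  have e : (v₂ + 1 + (v₁ - 1)) / 2 = (v₁ + v₂) / 2 := by ring
  ext
  · simp only [backlundInv]
    field_simp
  · simp only [backlundInv, e]
    field_simp
    ring

/-- This factorization removes `backlundNeg` from the generators in favour of a map that commutes
with the others. -/
theorem backlundInv_backlundMu {t : U} (ht : t ≠ 0) (v₁ v₂ : ℂ) {P : U × U} (hP : P.1 ≠ 0) :
    backlundInv t (1 - v₂) (1 - v₁) (backlundMu t v₁ v₂ P) = backlundNeg t v₁ P := by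
  have := charZero_of_complexAlgebra U
  ext
  · simp only [backlundInv, backlundMu, backlundNeg]
    field_simp
  · simp only [backlundInv, backlundMu, backlundNeg, map_div₀, map_add, map_sub, map_one,
      map_ofNat]
    field_simp
    ring

theorem backlundR_backlundInv {t : U} (ht : t ≠ 0) (v₁ v₂ : ℂ) {P : U × U} (hP : P.1 ≠ 0)
    (hPx : P.2 = 0 → v₁ + v₂ = 0) (hR : (backlundR v₁ v₂ P).1 ≠ 0) :
    backlundR (v₂ + 1) (v₁ - 1) (backlundInv t v₁ v₂ P) =
      backlundInv t (-v₂) (-v₁) (backlundR v₁ v₂ P) := by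
  have := charZero_of_complexAlgebra U
  have e : v₂ + 1 + (v₁ - 1) = v₁ + v₂ := by ring
  have e' : -v₂ + -v₁ = -(v₁ + v₂) := by ring
  simp only [backlundR, backlundInv, e, e'] at hR ⊢
  generalize v₁ + v₂ = b at *
  by_cases hb : b = 0
  · simp [hb]
  have hx : P.2 ≠ 0 := fun h => hb (hPx h)
  simp only [neg_div, map_neg, map_div₀, map_ofNat]
  -- N = 2yx + b is the numerator of the new first coordinate, nonzero by `hR`.
  obtain ⟨N, hN⟩ : ∃ N, algebraMap ℂ U b = N - 2 * P.1 * P.2 := ⟨_, (add_sub_cancel_right _ _).symm⟩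
  have key : P.1 + algebraMap ℂ U b / (2 * P.2) = N / (2 * P.2) := by
    rw [hN]
    field_simp
    ring
  have key2 : P.1 * P.2 + algebraMap ℂ U b / 2 = N / 2 := by
    rw [hN]
    field_simp
    ring
  have hN0 : N ≠ 0 := by
    rintro rfl
    rw [key, zero_div] at hR
    exact hR rfl
  rw [key, key2, hN]
  ext
  · field_simp
    ring
  · field_simp
    ring

theorem backlundR_backlundS (v₁ v₂ : ℂ) (P : U × U) :
    backlundR v₂ v₁ (backlundS v₁ v₂ P) = backlundS (-v₂) (-v₁) (backlundR v₁ v₂ P) := by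
  have e : -v₂ - -v₁ = v₁ - v₂ := by ring
  ext
  · simp only [backlundR, backlundS, e, add_comm v₂ v₁]
    ring
  · rfl

theorem backlundMu_backlundInv {t : U} (ht : t ≠ 0) (v₁ v₂ : ℂ) {P : U × U} (hP : P.1 ≠ 0) :
    backlundMu t (v₂ + 1) (v₁ - 1) (backlundInv t v₁ v₂ P) =
      backlundInv t (1 - v₂) (1 - v₁) (backlundMu t v₁ v₂ P) := by
  have := charZero_of_complexAlgebra U
  ext
  · simp only [backlundInv, backlundMu]
    field_simp
  · simp only [backlundInv, backlundMu, map_div₀, map_add, map_sub, map_one, map_ofNat]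
    field_simp
    ring

theorem backlundMu_backlundS {t : U} (ht : t ≠ 0) (v₁ v₂ : ℂ) {P : U × U} (hP : P.1 ≠ 0)
    (hP1 : P.2 = 1 → v₁ = v₂) (hS : (backlundS v₁ v₂ P).1 ≠ 0) :
    backlundMu t v₂ v₁ (backlundS v₁ v₂ P) =
      backlundS (1 - v₂) (1 - v₁) (backlundMu t v₁ v₂ P) := by
  have := charZero_of_complexAlgebra U
  by_cases h12 : v₁ = v₂
  · subst h12
    rw [backlundS_self, backlundS_self]
  have hx : P.2 - 1 ≠ 0 := sub_ne_zero.mpr fun h => h12 (hP1 h)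
  have e : 1 - v₂ - (1 - v₁) = v₁ - v₂ := by ring
  have e' : (v₂ - v₁) / 2 = -((v₁ - v₂) / 2) := by ring
  simp only [backlundMu, backlundS, e, e'] at hS ⊢
  generalize v₁ - v₂ = a at *
  simp only [map_neg, map_div₀, map_ofNat]
  generalize P.2 - 1 = u at *
  have key : P.1 + algebraMap ℂ U a / (2 * u) = (2 * P.1 * u + algebraMap ℂ U a) / (2 * u) := by
    field_simp
  have hS' : 2 * P.1 * u + algebraMap ℂ U a ≠ 0 := by
    intro h
    rw [key, h, zero_div] at hS
    exact hS rfl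
  have key2 : P.1 * u + algebraMap ℂ U a / 2 = (2 * P.1 * u + algebraMap ℂ U a) / 2 := by
    field_simp
  ext
  · simp only [key, key2]
    field_simp
    ring
  · simp only [key, key2]
    field_simp
    ring

variable {D : Derivation ℂ U U} {t : U}

theorem gen_ne_zero (ht : D t = 1) : t ≠ 0 := by
  rintro rfl
  simp at ht

theorem deriv_two (D : Derivation ℂ U U) : D 2 = 0 := by
  have h := D.map_algebraMap (2 : ℂ)
  rwa [map_ofNat] at h

namespace systemIII

variable {v₁ v₂ : ℂ} {P : U × U}

theorem fst_ne_zero (ht : D t = 1) (hP : P ∈ systemIII D t v₁ v₂) : P.1 ≠ 0 := by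
  intro h
  have h1 := hP.1
  have := gen_ne_zero ht
  simp [h, this] at h1

theorem eq_of_snd_eq_one (ht : D t = 1) (hP : P ∈ systemIII D t v₁ v₂) (h : P.2 = 1) :
    v₁ = v₂ := by
  have := charZero_of_complexAlgebra U
  have h1 := hP.2
  have ht0 := gen_ne_zero ht
  simp only [h, Derivation.map_one_eq_zero, map_div₀, map_add, map_ofNat] at h1
  field_simp at h1
  apply (algebraMap ℂ U).injective
  linear_combination h1

theorem add_eq_zero_of_snd_eq_zero (ht : D t = 1) (hP : P ∈ systemIII D t v₁ v₂) (h : P.2 = 0) :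
    v₁ + v₂ = 0 := by
  have h1 := hP.2
  have ht0 := gen_ne_zero ht
  simp only [h, map_zero] at h1
  field_simp at h1
  apply (algebraMap ℂ U).injective
  simp only [map_div₀, map_ofNat] at h1
  have := charZero_of_complexAlgebra U
  field_simp at h1
  simpa using h1.symm

theorem backlundS_mem (ht : D t = 1) (hP : P ∈ systemIII D t v₁ v₂) :
    backlundS v₁ v₂ P ∈ systemIII D t v₂ v₁ := by
  have := charZero_of_complexAlgebra U
  by_cases h12 : v₁ = v₂
  · subst h12
    rwa [backlundS_self]
  have hx : P.2 - 1 ≠ 0 := sub_ne_zero.mpr fun h => h12 (eq_of_snd_eq_one ht hP h)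
  have ht0 := gen_ne_zero ht
  obtain ⟨h1, h2⟩ := hP
  have hD2 := deriv_two D
  constructor
  · simp only [backlundS, map_add, Derivation.leibniz_div, Derivation.leibniz, map_sub, h1, h2,
      Derivation.map_algebraMap, Derivation.map_one_eq_zero, smul_eq_mul, hD2, map_div₀, map_ofNat]
    field_simp
    ring
  · simp only [backlundS, h2, map_add, map_sub, map_div₀, map_ofNat]
    field_simp
    ring

theorem backlundInv_mem (ht : D t = 1) (hP : P ∈ systemIII D t v₁ v₂) :
    backlundInv t v₁ v₂ P ∈ systemIII D t (v₂ + 1) (v₁ - 1) := by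
  have := charZero_of_complexAlgebra U
  have hy := fst_ne_zero ht hP
  have ht0 := gen_ne_zero ht
  have hD2 := deriv_two D
  obtain ⟨h1, h2⟩ := hP
  constructor
  · simp only [backlundInv, Derivation.leibniz_div, h1, ht, smul_eq_mul, map_add, map_one,
      map_div₀, map_ofNat]
    field_simp
    ring
  · simp only [backlundInv, Derivation.leibniz_div, Derivation.leibniz, map_add, map_neg, map_sub,
      h1, h2, ht, hD2, Derivation.map_algebraMap, smul_eq_mul, map_one, map_div₀, map_ofNat]
    field_simp
    ring

end systemIII

theorem ric_subset_systemIII {v : ℂ} : ric D t v ⊆ systemIII D t v v := by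
  have := charZero_of_complexAlgebra U
  rintro ⟨y, x⟩ ⟨h1, h2⟩
  simp only at h1 h2
  subst h2
  constructor
  · simp only [h1]
    ring
  · simp only [Derivation.map_one_eq_zero, map_div₀, map_add, map_ofNat]
    ring

theorem backlundR_mem_ric {v : ℂ} {P : U × U} (hP : P ∈ ric D t v) :
    backlundR v v P ∈ ric D t (-v) := by
  have := charZero_of_complexAlgebra U
  obtain ⟨h1, h2⟩ := hP
  refine ⟨?_, h2⟩
  simp only [backlundR, h2, map_add, map_neg, h1]
  have e : (algebraMap ℂ U v + algebraMap ℂ U v) / (2 * 1) = algebraMap ℂ U v := by ring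
  rw [e, Derivation.map_algebraMap]
  ring

theorem backlundMu_mem_ric (ht : D t = 1) {v : ℂ} {P : U × U} (hP : P ∈ ric D t v) :
    backlundMu t v v P ∈ ric D t (1 - v) := by
  have hy := systemIII.fst_ne_zero ht (ric_subset_systemIII hP)
  have ht0 := gen_ne_zero ht
  obtain ⟨h1, h2⟩ := hP
  refine ⟨?_, by simp [backlundMu, h2]⟩
  simp only [backlundMu, Derivation.leibniz_div, map_neg, h1, ht, smul_eq_mul, map_sub, map_one]
  field_simp
  ring

/-! ### Alternating chains as a normal form for the orbit. -/

/-- Half the difference of the parameters after `n` alternating steps `backlundInv`, `backlundS`. -/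
def halfGap : ℕ → ℤ
  | 0 => 0
  | n + 1 => if Even n then 1 - halfGap n else -halfGap n

/-- The sequence runs 0, 1, -1, 2, -2, …, so the parameter gap determines the length of the chain.
-/
theorem halfGap_spec (n : ℕ) :
    (Even n → (n : ℤ) = -2 * halfGap n) ∧ (¬ Even n → (n : ℤ) = 2 * halfGap n - 1) := by
  induction n with
  | zero => simp [halfGap]
  | succ n ih =>
    rw [Nat.even_add_one, halfGap]
    by_cases h : Even n
    · have := ih.1 h
      simp only [h, if_true, not_true, not_false_iff, false_imp_iff, true_imp_iff, true_and]
      push_cast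
      omega
    · have := ih.2 h
      simp only [h, if_false, not_true, not_false_iff, false_imp_iff, true_imp_iff, and_true]
      push_cast
      omega

theorem halfGap_injective : Function.Injective halfGap := by
  intro m n h
  have hm := halfGap_spec m
  have hn := halfGap_spec n
  by_cases h1 : Even m <;> by_cases h2 : Even n <;> simp [h1, h2] at hm hn <;> omega

/-- `n` alternating steps `backlundInv`, `backlundS`, started at the parameters `(w, w)`. -/
noncomputable def chain (t : U) (w : ℂ) : ℕ → U × U → U × U
  | 0 => id
  | n + 1 => fun P => if Even n then backlundInv t (w + halfGap n) (w - halfGap n) (chain t w n P)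
      else backlundS (w + halfGap n) (w - halfGap n) (chain t w n P)

theorem chain_succ_of_even {n : ℕ} (hn : Even n) (w : ℂ) (P : U × U) :
    chain t w (n + 1) P = backlundInv t (w + halfGap n) (w - halfGap n) (chain t w n P) := by
  simp [chain, hn]

theorem chain_succ_of_not_even {n : ℕ} (hn : ¬ Even n) (w : ℂ) (P : U × U) :
    chain t w (n + 1) P = backlundS (w + halfGap n) (w - halfGap n) (chain t w n P) := by
  simp [chain, hn]

theorem halfGap_succ_of_even {n : ℕ} (hn : Even n) : halfGap (n + 1) = 1 - halfGap n := by
  simp [halfGap, hn]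

theorem halfGap_succ_of_not_even {n : ℕ} (hn : ¬ Even n) : halfGap (n + 1) = -halfGap n := by
  simp [halfGap, hn]

theorem params_succ_of_even {n : ℕ} (hn : Even n) (w : ℂ) :
    w + halfGap (n + 1) = w - halfGap n + 1 ∧ w - halfGap (n + 1) = w + halfGap n - 1 := by
  rw [halfGap_succ_of_even hn]
  constructor <;> (push_cast; ring)

theorem params_succ_of_not_even {n : ℕ} (hn : ¬ Even n) (w : ℂ) :
    w + halfGap (n + 1) = w - halfGap n ∧ w - halfGap (n + 1) = w + halfGap n := by
  rw [halfGap_succ_of_not_even hn]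
  constructor <;> (push_cast; ring)

theorem chain_mem_systemIII (ht : D t = 1) {w : ℂ} {P : U × U} (hP : P ∈ ric D t w) (n : ℕ) :
    chain t w n P ∈ systemIII D t (w + halfGap n) (w - halfGap n) := by
  induction n with
  | zero => simpa [chain, halfGap] using ric_subset_systemIII hP
  | succ n ih =>
    by_cases hn : Even n
    · rw [chain_succ_of_even hn, (params_succ_of_even hn w).1, (params_succ_of_even hn w).2]
      exact systemIII.backlundInv_mem ht ih
    · rw [chain_succ_of_not_even hn, (params_succ_of_not_even hn w).1,
        (params_succ_of_not_even hn w).2]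
      exact systemIII.backlundS_mem ht ih

/-- Commuting with each letter of the word, `backlundR` moves down to the Riccati point at its base.
-/
theorem backlundR_chain (ht : D t = 1) {w : ℂ} {P : U × U} (hP : P ∈ ric D t w) (n : ℕ) :
    backlundR (w + halfGap n) (w - halfGap n) (chain t w n P) =
      chain t (-w) n (backlundR w w P) := by
  induction n with
  | zero => simp [chain, halfGap]
  | succ n ih =>
    have hsys := chain_mem_systemIII ht hP n
    have hsys' := chain_mem_systemIII ht (backlundR_mem_ric hP) n
    have e1 : -w + halfGap n = -(w - halfGap n) := by ring
    have e2 : -w - halfGap n = -(w + halfGap n) := by ring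
    by_cases hn : Even n
    · rw [chain_succ_of_even hn, chain_succ_of_even hn, (params_succ_of_even hn w).1,
        (params_succ_of_even hn w).2, ← ih, e1, e2]
      refine backlundR_backlundInv (gen_ne_zero ht) _ _ (systemIII.fst_ne_zero ht hsys)
        (systemIII.add_eq_zero_of_snd_eq_zero ht hsys) ?_
      rw [ih]
      exact systemIII.fst_ne_zero ht hsys'
    · rw [chain_succ_of_not_even hn, chain_succ_of_not_even hn, (params_succ_of_not_even hn w).1,
        (params_succ_of_not_even hn w).2, ← ih, e1, e2]
      exact backlundR_backlundS _ _ _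

theorem backlundMu_chain (ht : D t = 1) {w : ℂ} {P : U × U} (hP : P ∈ ric D t w) (n : ℕ) :
    backlundMu t (w + halfGap n) (w - halfGap n) (chain t w n P) =
      chain t (1 - w) n (backlundMu t w w P) := by
  induction n with
  | zero => simp [chain, halfGap]
  | succ n ih =>
    have hsys := chain_mem_systemIII ht hP n
    have hy := systemIII.fst_ne_zero ht hsys
    have e1 : 1 - w + halfGap n = 1 - (w - halfGap n) := by ring
    have e2 : 1 - w - halfGap n = 1 - (w + halfGap n) := by ring
    by_cases hn : Even n
    · rw [chain_succ_of_even hn, chain_succ_of_even hn, (params_succ_of_even hn w).1,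
        (params_succ_of_even hn w).2, ← ih, e1, e2]
      exact backlundMu_backlundInv (gen_ne_zero ht) _ _ hy
    · rw [chain_succ_of_not_even hn, chain_succ_of_not_even hn, (params_succ_of_not_even hn w).1,
        (params_succ_of_not_even hn w).2, ← ih, e1, e2]
      exact backlundMu_backlundS (gen_ne_zero ht) _ _ hy (systemIII.eq_of_snd_eq_one ht hsys)
        (systemIII.fst_ne_zero ht (systemIII.backlundS_mem ht hsys))

/-- A point reached from some `ric(w)` by alternating steps `backlundInv`, `backlundS`. -/
def IsChainPoint (D : Derivation ℂ U U) (t : U) (v₁ v₂ : ℂ) (P : U × U) : Prop :=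
  ∃ (n : ℕ) (w : ℂ) (Q : U × U), Q ∈ ric D t w ∧ v₁ = w + halfGap n ∧ v₂ = w - halfGap n ∧
    P = chain t w n Q

namespace IsChainPoint

variable {v₁ v₂ : ℂ} {P : U × U}

theorem fst_ne_zero (ht : D t = 1) (h : IsChainPoint D t v₁ v₂ P) : P.1 ≠ 0 := by
  obtain ⟨n, w, Q, hQ, rfl, rfl, rfl⟩ := h
  exact systemIII.fst_ne_zero ht (chain_mem_systemIII ht hQ n)

/-- Since `backlundS` is an involution, it either lengthens the word or cancels its last letter; on
the empty word the parameters agree and it is the identity. -/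
theorem stepS (h : IsChainPoint D t v₁ v₂ P) : IsChainPoint D t v₂ v₁ (backlundS v₁ v₂ P) := by
  obtain ⟨n, w, Q, hQ, rfl, rfl, rfl⟩ := h
  rcases n with _ | n
  · refine ⟨0, w, Q, hQ, by simp [halfGap], by simp [halfGap], ?_⟩
    simp only [halfGap, Int.cast_zero, add_zero, sub_zero]
    exact backlundS_self w _
  by_cases hn : Even n
  · have hn' : ¬ Even (n + 1) := by rwa [Nat.even_add_one, not_not]
    exact ⟨n + 2, w, Q, hQ, (params_succ_of_not_even hn' w).1.symm,
      (params_succ_of_not_even hn' w).2.symm, (chain_succ_of_not_even hn' w Q).symm⟩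
  · refine ⟨n, w, Q, hQ, (params_succ_of_not_even hn w).2, (params_succ_of_not_even hn w).1, ?_⟩
    rw [chain_succ_of_not_even hn, (params_succ_of_not_even hn w).1,
      (params_succ_of_not_even hn w).2, backlundS_backlundS]

theorem stepInv (ht : D t = 1) (h : IsChainPoint D t v₁ v₂ P) :
    IsChainPoint D t (v₂ + 1) (v₁ - 1) (backlundInv t v₁ v₂ P) := by
  obtain ⟨n, w, Q, hQ, rfl, rfl, rfl⟩ := h
  by_cases hn : Even n
  · exact ⟨n + 1, w, Q, hQ, (params_succ_of_even hn w).1.symm,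
      (params_succ_of_even hn w).2.symm, (chain_succ_of_even hn w Q).symm⟩
  · obtain ⟨m, rfl⟩ : ∃ m, n = m + 1 :=
      Nat.exists_eq_add_one.mpr (Nat.pos_of_ne_zero fun h => hn (h ▸ Even.zero))
    have hm : Even m := by rwa [Nat.even_add_one, not_not] at hn
    have hp := params_succ_of_even hm w
    refine ⟨m, w, Q, hQ, by rw [hp.2]; ring, by rw [hp.1]; ring, ?_⟩
    rw [chain_succ_of_even hm, hp.1, hp.2]
    exact backlundInv_backlundInv (gen_ne_zero ht) _ _
      (systemIII.fst_ne_zero ht (chain_mem_systemIII ht hQ m))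

theorem stepR (ht : D t = 1) (h : IsChainPoint D t v₁ v₂ P) :
    IsChainPoint D t (-v₂) (-v₁) (backlundR v₁ v₂ P) := by
  obtain ⟨n, w, Q, hQ, rfl, rfl, rfl⟩ := h
  exact ⟨n, -w, backlundR w w Q, backlundR_mem_ric hQ, by ring, by ring, backlundR_chain ht hQ n⟩

theorem stepMu (ht : D t = 1) (h : IsChainPoint D t v₁ v₂ P) :
    IsChainPoint D t (1 - v₂) (1 - v₁) (backlundMu t v₁ v₂ P) := by
  obtain ⟨n, w, Q, hQ, rfl, rfl, rfl⟩ := h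
  exact ⟨n, 1 - w, backlundMu t w w Q, backlundMu_mem_ric ht hQ, by ring, by ring,
    backlundMu_chain ht hQ n⟩

theorem stepNeg (ht : D t = 1) (h : IsChainPoint D t v₁ v₂ P) :
    IsChainPoint D t (2 - v₁) (-v₂) (backlundNeg t v₁ P) := by
  have h1 := (h.stepMu ht).stepInv ht
  rw [backlundInv_backlundMu (gen_ne_zero ht) _ _ (h.fst_ne_zero ht)] at h1
  have e1 : 1 - v₁ + 1 = 2 - v₁ := by ring
  have e2 : 1 - v₂ - 1 = -v₂ := by ring
  rwa [e1, e2] at h1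

end IsChainPoint

theorem RiccatiOrbit.isChainPoint (ht : D t = 1) {v₁ v₂ : ℂ} {P : U × U}
    (h : RiccatiOrbit D t v₁ v₂ P) : IsChainPoint D t v₁ v₂ P := by
  induction h with
  | base v P hP => exact ⟨0, v, P, hP, by simp [halfGap], by simp [halfGap], rfl⟩
  | stepS _ _ _ _ ih => exact ih.stepS
  | stepR _ _ _ _ ih => exact ih.stepR ht
  | stepInv _ _ _ _ ih => exact ih.stepInv ht
  | stepNeg _ _ _ _ ih => exact ih.stepNeg ht

/-- Two chain points at the same parameters are reached by the same chain. -/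
theorem IsChainPoint.exists_common_chain {v₁ v₂ : ℂ} {P P' : U × U}
    (h : IsChainPoint D t v₁ v₂ P) (h' : IsChainPoint D t v₁ v₂ P') :
    ∃ (n : ℕ) (w : ℂ) (Q Q' : U × U), Q ∈ ric D t w ∧ Q' ∈ ric D t w ∧ v₁ = w + halfGap n ∧
      v₂ = w - halfGap n ∧ P = chain t w n Q ∧ P' = chain t w n Q' := by
  obtain ⟨n, w, Q, hQ, h1, h2, hP⟩ := h
  obtain ⟨n', w', Q', hQ', h1', h2', hP'⟩ := h'
  -- The sum of the parameters is 2w; their difference then fixes the length.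
  obtain rfl : w = w' := by linear_combination (-h1 - h2 + h1' + h2') / 2
  obtain rfl : n = n' := by
    apply halfGap_injective
    have : ((halfGap n : ℤ) : ℂ) = halfGap n' := by linear_combination h1' - h1
    exact_mod_cast this
  exact ⟨n, w, Q, Q', hQ, hQ', h1, h2, hP, hP'⟩

/-- Each letter is a rational map over ℂ(t) that is its own inverse up to parameters, so membership
passes both ways. -/
theorem chain_mem_iff (ht : D t = 1) {w : ℂ} {P : U × U} (hP : P ∈ ric D t w) (n : ℕ)
    (M : Subfield U) (hM : ∀ c, algebraMap ℂ U c ∈ M) (htM : t ∈ M) :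
    ((chain t w n P).1 ∈ M ∧ (chain t w n P).2 ∈ M) ↔ (P.1 ∈ M ∧ P.2 ∈ M) := by
  have h2 : (2 : U) ∈ M := by simpa only [map_ofNat] using hM 2
  have hS : ∀ v₁ v₂ (Q : U × U), Q.1 ∈ M ∧ Q.2 ∈ M →
      (backlundS v₁ v₂ Q).1 ∈ M ∧ (backlundS v₁ v₂ Q).2 ∈ M := fun v₁ v₂ Q hQ =>
    ⟨add_mem hQ.1 (div_mem (hM _) (mul_mem h2 (sub_mem hQ.2 (one_mem _)))), hQ.2⟩
  have hI : ∀ v₁ v₂ (Q : U × U), Q.1 ∈ M ∧ Q.2 ∈ M →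
      (backlundInv t v₁ v₂ Q).1 ∈ M ∧ (backlundInv t v₁ v₂ Q).2 ∈ M := fun v₁ v₂ Q hQ =>
    ⟨div_mem htM hQ.1, mul_mem (neg_mem (div_mem hQ.1 htM)) (add_mem (mul_mem hQ.1 hQ.2) (hM _))⟩
  induction n with
  | zero => rfl
  | succ n ih =>
    refine Iff.trans ?_ ih
    by_cases hn : Even n
    · rw [chain_succ_of_even hn]
      refine ⟨fun h => ?_, hI _ _ _⟩
      rw [← backlundInv_backlundInv (gen_ne_zero ht) (w + halfGap n) (w - halfGap n)
        (systemIII.fst_ne_zero ht (chain_mem_systemIII ht hP n))]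
      exact hI _ _ _ h
    · rw [chain_succ_of_not_even hn]
      refine ⟨fun h => ?_, hS _ _ _⟩
      rw [← backlundS_backlundS (w + halfGap n) (w - halfGap n) (chain t w n P)]
      exact hS _ _ _ h

end Orbit

end PainleveThree

/-! ### Transcendence degree and interalgebraic replacement. -/

namespace PainleveThree

open Polynomial
open scoped Differential

section TranscendenceDegree

theorem trdeg_adjoin_range {K U ι : Type*} [Field K] [Field U] [Algebra K U] [Fintype ι]
    {x : ι → U} (hx : AlgebraicIndependent K x) :
    Algebra.trdeg K (IntermediateField.adjoin K (Set.range x)) = Fintype.card ι := by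
  have : Algebra.IsAlgebraic (MvPolynomial ι K) (FractionRing (MvPolynomial ι K)) :=
    IsLocalization.isAlgebraic _ (nonZeroDivisors (MvPolynomial ι K))
  have hb := (IsTranscendenceBasis.mvPolynomial ι K).algebraMap_comp
    (A := FractionRing (MvPolynomial ι K))
  have h1 := hb.lift_cardinalMk_eq_trdeg
  have h2 := hx.aevalEquivField.lift_trdeg_eq
  rw [Cardinal.mk_fintype, Cardinal.lift_natCast, eq_comm, Cardinal.lift_eq_nat_iff] at h1
  rw [h1, Cardinal.lift_natCast, eq_comm, Cardinal.lift_eq_nat_iff] at h2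
  exact h2

theorem algebraicIndependent_pair {K U : Type*} [Field K] [Field U] [Algebra K U] {x y : U}
    (hx : Transcendental K x) (hy : Transcendental (Algebra.adjoin K {x}) y) :
    AlgebraicIndependent K ![x, y] := by
  rw [AlgebraicIndependent.iff_transcendental_adjoin_image (1 : Fin 2)]
  have hc : ({1}ᶜ : Set (Fin 2)) = {0} := by ext i; fin_cases i <;> simp
  constructor
  · have : Subsingleton {j : Fin 2 // j ≠ 1} := ⟨fun a b => Subtype.ext (by omega)⟩
    rw [algebraicIndependent_singleton_iff ⟨(0 : Fin 2), by decide⟩]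
    exact hx
  · rw [hc, Set.image_singleton]
    exact hy

variable {K U : Type*} [Field K] [Field U] [Algebra K U]

theorem mem_matroid_closure_iff {s : Set U} {x : U} :
    x ∈ (AlgebraicIndependent.matroid K U).closure s ↔ IsAlgebraic (Algebra.adjoin K s) x := by
  rw [AlgebraicIndependent.matroid_closure_eq]
  rfl

/-- Transcendental elements may be replaced by interalgebraic ones in an independent pair. -/
theorem transcendental_adjoin_of_interalgebraic {q r x y : U}
    (hy : Transcendental K y) (hr : Transcendental (Algebra.adjoin K {q}) r)
    (hxq : IsAlgebraic (Algebra.adjoin K {q}) x) (hyr : IsAlgebraic (Algebra.adjoin K {r}) y) :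
    Transcendental (Algebra.adjoin K {x}) y := by
  set M := AlgebraicIndependent.matroid K U with hM
  have hempty : ∀ {a : U}, Transcendental K a → a ∉ M.closure ∅ := by
    intro a ha h
    rw [mem_matroid_closure_iff] at h
    apply ha
    rw [Algebra.adjoin_empty] at h
    exact h.restrictScalars K
  -- Matroid exchange: if a is transcendental over K and algebraic over K(b), then b is algebraic
  -- over K(a).
  have hex : ∀ {a b : U}, Transcendental K a → IsAlgebraic (Algebra.adjoin K {b}) a →
      b ∈ M.closure {a} := by
    intro a b ha hab
    have h1 : a ∈ M.closure (insert b ∅) \ M.closure ∅ := by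
      refine ⟨?_, hempty ha⟩
      rw [insert_empty_eq]
      exact mem_matroid_closure_iff.mpr hab
    have h2 := (M.closure_exchange h1).1
    rwa [insert_empty_eq] at h2
  -- An algebraic y would put r in the closure of y, hence of x, hence of q.
  intro h
  have h1 : y ∈ M.closure {x} := mem_matroid_closure_iff.mpr h
  have h2 : M.closure {x} ⊆ M.closure {q} := by
    refine M.closure_subset_closure_of_subset_closure (Set.singleton_subset_iff.mpr ?_)
    exact mem_matroid_closure_iff.mpr hxq
  have h3 : M.closure {y} ⊆ M.closure {q} :=
    M.closure_subset_closure_of_subset_closure (Set.singleton_subset_iff.mpr (h2 h1))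
  exact hr (mem_matroid_closure_iff.mp (h3 (hex hy hyr)))

end TranscendenceDegree

/-- The derivative of an algebraic element is algebraic. -/
theorem isAlgebraic_deriv {K U : Type*} [Field K] [CharZero K] [Field U] [Algebra K U]
    [Differential K] [Differential U] [DifferentialAlgebra K U] {x : U} (hx : IsAlgebraic K x) :
    IsAlgebraic K x′ := by
  have hint := hx.isIntegral
  have hsep : aeval x (derivative (minpoly K x)) ≠ 0 :=
    (minpoly.irreducible hint).separable.aeval_derivative_ne_zero (minpoly.aeval K x)
  have h := Differential.deriv_aeval_eq x (minpoly K x)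
  rw [minpoly.aeval, map_zero] at h
  have hx' : x′ = -aeval x (Differential.mapCoeffs (minpoly K x)) /
      aeval x (derivative (minpoly K x)) := by
    rw [eq_div_iff hsep]
    linear_combination -h
  have hmem : ∀ Q : K[X], aeval x Q ∈ K⟮x⟯ := fun Q =>
    (IntermediateField.mem_adjoin_simple_iff K _).mpr ⟨Q, 1, by simp⟩
  have hx'' : x′ ∈ K⟮x⟯ := hx' ▸ div_mem (neg_mem (hmem _)) (hmem _)
  have := IntermediateField.isAlgebraic_adjoin_simple hint
  exact (Algebra.IsAlgebraic.isAlgebraic (R := K) (⟨x′, hx''⟩ : K⟮x⟯)).algebraMap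

/-! ### Transfer to U with the derivation t D and to the chain points. -/

section Field

variable {U : Type*} [Field U] [Algebra ℂ U]

/-- The derivation `t D` on `U`. -/
@[reducible]
def eulerDifferential (D : Derivation ℂ U U) (t : U) : Differential U :=
  differentialOfLeibniz
    { toFun := fun x => t * D x
      map_zero' := by simp
      map_add' := fun a b => by rw [map_add, mul_add] }
    fun a b => by
      change t * D (a * b) = a * (t * D b) + b * (t * D a)
      rw [Derivation.leibniz, smul_eq_mul, smul_eq_mul]
      ring

theorem eulerDifferential_apply (D : Derivation ℂ U U) (t x : U) :
    letI := eulerDifferential D t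
    x′ = t * D x := rfl

theorem eulerDifferential_stable {D : Derivation ℂ U U} {t : U} (ht : D t = 1) :
    letI := eulerDifferential D t
    ∀ x ∈ ℂ⟮t⟯, x′ ∈ ℂ⟮t⟯ := by
  let _ := eulerDifferential D t
  intro x hx
  obtain ⟨r, s, rfl⟩ := (IntermediateField.mem_adjoin_simple_iff ℂ x).mp hx
  have hmem : ∀ Q : ℂ[X], aeval t Q ∈ ℂ⟮t⟯ := fun Q =>
    (IntermediateField.mem_adjoin_simple_iff ℂ _).mpr ⟨Q, 1, by simp⟩
  have hd : ∀ Q : ℂ[X], (aeval t Q)′ = aeval t (X * derivative Q) := fun Q =>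
    deriv_eval₂_const (ι := algebraMap ℂ U) (fun c => by rw [eulerDifferential_apply]; simp)
      (by rw [eulerDifferential_apply, ht, mul_one]) Q
  rw [deriv_div, hd, hd]
  exact div_mem (sub_mem (mul_mem (hmem _) (hmem _)) (mul_mem (hmem _) (hmem _))) (pow_mem (hmem _) 2)

theorem isEulerField_adjoin {D : Derivation ℂ U U} {t : U} (ht : D t = 1) :
    letI := eulerDifferential D t
    letI := differentialOfStable ℂ⟮t⟯ (eulerDifferential_stable ht)
    IsEulerField (algebraMap ℂ ℂ⟮t⟯) (IntermediateField.AdjoinSimple.gen ℂ t) := by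
  let _ := eulerDifferential D t
  let _ := differentialOfStable ℂ⟮t⟯ (eulerDifferential_stable ht)
  constructor
  · intro c
    apply Subtype.ext
    change t * D (algebraMap ℂ U c) = 0
    simp
  · apply Subtype.ext
    change t * D t = t
    rw [ht, mul_one]
  · intro h
    exact gen_ne_zero ht (congrArg Subtype.val h)
  · rintro ⟨x, hx⟩
    obtain ⟨r, s, rfl⟩ := (IntermediateField.mem_adjoin_simple_iff ℂ x).mp hx
    refine ⟨r, s, Subtype.ext ?_⟩
    change _ = algebraMap ℂ⟮t⟯ U (_ / _)
    rw [map_div₀, hom_eval₂, hom_eval₂]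
    rfl

theorem deriv_of_mem_ric {D : Derivation ℂ U U} {t : U} (ht : D t = 1) {w : ℂ} {P : U × U}
    (hP : P ∈ ric D t w) :
    letI := eulerDifferential D t
    (P.1)′ = P.1 ^ 2 + algebraMap ℂ⟮t⟯ U (algebraMap ℂ ℂ⟮t⟯ w) * P.1 +
      algebraMap ℂ⟮t⟯ U (IntermediateField.AdjoinSimple.gen ℂ t) := by
  change t * D P.1 = P.1 ^ 2 + algebraMap ℂ U w * P.1 + t
  have := gen_ne_zero ht
  rw [hP.1]
  field_simp

theorem transcendental_of_mem_ric {D : Derivation ℂ U U} {t : U} (ht : D t = 1) {w : ℂ}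
    (hw : ∀ k : ℤ, w ≠ 1 / 2 + k) {P : U × U} (hP : P ∈ ric D t w) :
    Transcendental ℂ⟮t⟯ P.1 := by
  let _ := eulerDifferential D t
  let _ := differentialOfStable ℂ⟮t⟯ (eulerDifferential_stable ht)
  have := differentialAlgebra_of_stable ℂ⟮t⟯ (eulerDifferential_stable ht)
  exact (isEulerField_adjoin ht).transcendental hw (deriv_of_mem_ric ht hP)

theorem transcendental_adjoin_of_mem_ric {D : Derivation ℂ U U} {t : U} (ht : D t = 1) {w : ℂ}
    (hw : ∀ k : ℤ, w ≠ 1 / 2 + k) {P Q : U × U} (hP : P ∈ ric D t w) (hQ : Q ∈ ric D t w)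
    (hPQ : P ≠ Q) : Transcendental (Algebra.adjoin ℂ⟮t⟯ {P.1}) Q.1 := by
  let _ := eulerDifferential D t
  let _ := differentialOfStable ℂ⟮t⟯ (eulerDifferential_stable ht)
  have := differentialAlgebra_of_stable ℂ⟮t⟯ (eulerDifferential_stable ht)
  rw [← IntermediateField.transcendental_adjoin_iff]
  exact (isEulerField_adjoin ht).transcendental_over_adjoin hw (deriv_of_mem_ric ht hP)
    (deriv_of_mem_ric ht hQ) fun h => hPQ (Prod.ext h (hP.2.trans hQ.2.symm))

/-- Riccati points have x = 1, so at the base of the chain only the first coordinate matters. -/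
theorem chain_mem_intermediateField_iff {D : Derivation ℂ U U} {t : U} (ht : D t = 1) {w : ℂ}
    {P : U × U} (hP : P ∈ ric D t w) (n : ℕ) (M : IntermediateField ℂ⟮t⟯ U) :
    ((chain t w n P).1 ∈ M ∧ (chain t w n P).2 ∈ M) ↔ P.1 ∈ M := by
  have h := chain_mem_iff ht hP n M.toSubfield
    (fun c => M.algebraMap_mem (algebraMap ℂ ℂ⟮t⟯ c))
    (M.algebraMap_mem (IntermediateField.AdjoinSimple.gen ℂ t))
  refine h.trans ⟨fun h => h.1, fun h => ⟨h, ?_⟩⟩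
  rw [hP.2]
  exact one_mem _

theorem isAlgebraic_chain {D : Derivation ℂ U U} {t : U} (ht : D t = 1) {w : ℂ}
    {P : U × U} (hP : P ∈ ric D t w) (n : ℕ) :
    IsAlgebraic (Algebra.adjoin ℂ⟮t⟯ {P.1}) (chain t w n P).1 := by
  rw [← IntermediateField.isAlgebraic_adjoin_iff]
  have h := ((chain_mem_intermediateField_iff ht hP n ℂ⟮t⟯⟮P.1⟯).mpr
    (IntermediateField.mem_adjoin_simple_self _ _)).1
  exact isAlgebraic_algebraMap (⟨_, h⟩ : ℂ⟮t⟯⟮P.1⟯)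

/-- If y were algebraic, so would be t D y. The first equation of the system is linear in x with
coefficient 2y² ≠ 0, so x, and with it the Riccati point at the base, would be algebraic too. -/
theorem transcendental_chain {D : Derivation ℂ U U} {t : U} (ht : D t = 1) {w : ℂ}
    (hw : ∀ k : ℤ, w ≠ 1 / 2 + k) {P : U × U} (hP : P ∈ ric D t w) (n : ℕ) :
    Transcendental ℂ⟮t⟯ (chain t w n P).1 := by
  let _ := eulerDifferential D t
  let _ := differentialOfStable ℂ⟮t⟯ (eulerDifferential_stable ht)
  have := differentialAlgebra_of_stable ℂ⟮t⟯ (eulerDifferential_stable ht)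
  have := charZero_of_complexAlgebra U
  have : CharZero ℂ⟮t⟯ := charZero_of_complexAlgebra _
  intro halg
  have hsys := chain_mem_systemIII ht hP n
  have hy0 := systemIII.fst_ne_zero ht hsys
  have hD : IsAlgebraic ℂ⟮t⟯ (t * D (chain t w n P).1) := isAlgebraic_deriv halg
  have h1 := hsys.1
  set y := (chain t w n P).1
  set x := (chain t w n P).2
  set M := algebraicClosure ℂ⟮t⟯ U
  have hyM : y ∈ M := mem_algebraicClosure_iff.mpr halg
  have hDM : t * D y ∈ M := mem_algebraicClosure_iff.mpr hD
  have htM : t ∈ M := M.algebraMap_mem (IntermediateField.AdjoinSimple.gen ℂ t)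
  have hcM : algebraMap ℂ U (w + halfGap n) ∈ M := M.algebraMap_mem (algebraMap ℂ ℂ⟮t⟯ _)
  have h2M : (2 : U) ∈ M := ofNat_mem M 2
  have hx : x = (t * D y + y ^ 2 - algebraMap ℂ U (w + halfGap n) * y - t) / (2 * y ^ 2) := by
    have := gen_ne_zero ht
    rw [h1]
    field_simp
    ring
  have hxM : x ∈ M := by
    rw [hx]
    exact div_mem (sub_mem (sub_mem (add_mem hDM (pow_mem hyM 2)) (mul_mem hcM hyM)) htM)
      (mul_mem h2M (pow_mem hyM 2))
  exact transcendental_of_mem_ric ht hw hP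
    (mem_algebraicClosure_iff.mp ((chain_mem_intermediateField_iff ht hP n M).mp ⟨hyM, hxM⟩))

end Field

end PainleveThree

/-! ### The proposition. -/

theorem proposition3p2 {U : Type*} [Field U] [Algebra ℂ U] (D : Derivation ℂ U U)
    (t : U) (ht : D t = 1) (v₁ v₂ : ℂ)
    (hv : ∃ k : ℤ, v₁ - v₂ = 2 * (k : ℂ))
    (hhalf : ∀ k : ℤ, v₁ ≠ 1 / 2 + (k : ℂ))
    (y z : U × U)
    (hy : y ∈ PainleveThree.riccatiSubvariety D t v₁ v₂)
    (hz : z ∈ PainleveThree.riccatiSubvariety D t v₁ v₂)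
    (hyz : y ≠ z) :
    Algebra.trdeg ℂ⟮t⟯ (IntermediateField.adjoin ℂ⟮t⟯ ({y.1, y.2, z.1, z.2} : Set U)) = 2 ∧
      AlgebraicIndependent ℂ⟮t⟯ ![y.1, z.1] := by
  obtain ⟨n, w, q, r, hq, hr, hv₁, hv₂, hyc, hzc⟩ :=
    (hy.2.isChainPoint ht).exists_common_chain (hz.2.isChainPoint ht)
  -- w differs from v₁ by the integer `halfGap n`.
  have hw : ∀ k : ℤ, w ≠ 1 / 2 + k := by
    intro k hk
    apply hhalf (k + PainleveThree.halfGap n)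
    rw [hv₁, hk]
    push_cast
    ring
  have hne : q ≠ r := fun h => hyz (by rw [hyc, hzc, h])
  have hq' := PainleveThree.transcendental_of_mem_ric ht hw hq
  have hqr := PainleveThree.transcendental_adjoin_of_mem_ric ht hw hq hr hne
  -- The chain is birational over K, so both generating sets give the same field.
  have hadj : IntermediateField.adjoin ℂ⟮t⟯ ({y.1, y.2, z.1, z.2} : Set U) =
      IntermediateField.adjoin ℂ⟮t⟯ (Set.range ![q.1, r.1]) := by
    apply le_antisymm
    · have hmem : ∀ i, ![q.1, r.1] i ∈ IntermediateField.adjoin ℂ⟮t⟯ (Set.range ![q.1, r.1]) :=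
        fun i => IntermediateField.subset_adjoin _ _ ⟨i, rfl⟩
      have hyM := (PainleveThree.chain_mem_intermediateField_iff ht hq n _).mpr (hmem 0)
      have hzM := (PainleveThree.chain_mem_intermediateField_iff ht hr n _).mpr (hmem 1)
      rw [← hyc] at hyM
      rw [← hzc] at hzM
      rw [IntermediateField.adjoin_le_iff]
      rintro _ (rfl | rfl | rfl | rfl)
      exacts [hyM.1, hyM.2, hzM.1, hzM.2]
    · have hmem : ∀ a ∈ ({y.1, y.2, z.1, z.2} : Set U), a ∈
          IntermediateField.adjoin ℂ⟮t⟯ ({y.1, y.2, z.1, z.2} : Set U) :=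
        fun a ha => IntermediateField.subset_adjoin _ _ ha
      rw [IntermediateField.adjoin_le_iff]
      rintro _ ⟨i, rfl⟩
      fin_cases i
      · refine (PainleveThree.chain_mem_intermediateField_iff ht hq n _).mp ?_
        rw [← hyc]
        exact ⟨hmem _ (by simp), hmem _ (by simp)⟩
      · refine (PainleveThree.chain_mem_intermediateField_iff ht hr n _).mp ?_
        rw [← hzc]
        exact ⟨hmem _ (by simp), hmem _ (by simp)⟩
  constructor
  · rw [hadj, PainleveThree.trdeg_adjoin_range
      (PainleveThree.algebraicIndependent_pair hq' hqr)]
    simp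
  · rw [hyc, hzc]
    exact PainleveThree.algebraicIndependent_pair
      (PainleveThree.transcendental_chain ht hw hq n)
      (PainleveThree.transcendental_adjoin_of_interalgebraic
        (PainleveThree.transcendental_chain ht hw hr n) hqr
        (PainleveThree.isAlgebraic_chain ht hq n) (PainleveThree.isAlgebraic_chain ht hr n))
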